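/- **Theorem ($\Sigma\times\mathbb R^{2,2}$, analogue of Calabi's Theorem 6).** Let $\mathbb U$ be the algebra of split-quaternions, with real basis $1,i,j,k$, $i^2=-1$, $j^2=1$, $k=ij=-ji$, and let $\mathbb B=\{a+bl: a,b\in\mathbb U\}$ be the split-octonions, with product $$(a+bl)(c+dl)=(ac+l^2\,\bar d b)+(da+b\bar c)\,l,$$ where $l^2$ is either $1$ or $-1$. Put $\overline{a+bl}=\bar a-bl$, let $\langle\cdot,\cdot\rangle$ be the inner product that polarises $N(x)=x\bar x$, and let $X(a,b)=ab+\langle a,b\rangle 1$ be the 2-fold vector cross product on $\mathrm{Im}(\mathbb B)=\mathrm{Im}(\mathbb U)\oplus\mathbb U\,l\cong\mathbb R^{1,2}\oplus\mathbb R^{2,2}$, where $\mathrm{Im}(\mathbb U)=\mathbb R^{1,2}$ has orthogonal basis $i,j,k$ with $\langle i,i\rangle=1$, $\langle j,j\rangle=\langle k,k\rangle=-1$. Let $\Sigma$ be an oriented smooth surface and $f:\Sigma\to\mathbb R^{1,2}$ a smooth immersion whose induced metric has signature $(1,1)$. Let $n$ be its unit normal field, i.e. $\langle n,n\rangle=-1$,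 $n\perp df(T\Sigma)$, and $(n,df(e_1),df(e_2))$ is positively oriented with respect to $(i,j,k)$ for every positively oriented basis $(e_1,e_2)$ of a tangent space of $\Sigma$. Put $M=\Sigma\times\mathbb R^{2,2}$, immersed in $\mathrm{Im}(\mathbb B)$ by $\iota=f\times\mathrm{id}$, with unit normal field $\nu=(n,0)$, and let $L$ be the field of endomorphisms of $TM$ defined by $d\iota(Lv)=-X(\nu,d\iota(v))$. Then $L$ is an almost paracomplex structure on $M$ (it is smooth, $L^2=\mathrm{id}$, and its $\pm1$-eigenspaces are 3-dimensional at every point), and $L$ is integrable, i.e. its Nijenhuis tensor $$N_L(V,W)=[LV,LW]-L[LV,W]-L[V,LW]+[V,W]$$ vanishes for all smooth vector fields $V,W$ on open subsets of $M$, if and only if $\Sigma$ is minimal in $\mathbb R^{1,2}$, i.e. its mean curvature vector $\tfrac12\sum_{a,b}g^{ab}A(\partial_a,\partial_b)$ vanishes identically, where $g_{ab}=\langle\partial_a f,\partial_b f\rangle$ and $A(\partial_a,\partial_b)$ is the normal component of $\partial_a\partial_b f$. -/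

import Mathlib

open scoped Manifold ContDiff

noncomputable section

namespace ParaCalabi

/-! ### Split-quaternions, split-octonions and the 2-fold cross product -/

/-- The split-quaternions: real basis `1, i, j, k` with `i² = -1`, `j² = 1`, `k = ij = -ji`.
Here `star` is the conjugation `a ↦ ā`. -/
abbrev SplitQuaternion : Type := QuaternionAlgebra ℝ (-1) 0 1

/-- The split-octonions `𝔹`: elements `a + b l` with `a`, `b` split-quaternions.
The real parameter `s` is the value of `l²`, which may be `1` or `-1`. -/
@[ext]
structure SplitOctonion (s : ℝ) where
  /-- The component `a` of `a + b l`. -/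
  a : SplitQuaternion
  /-- The component `b` of `a + b l`. -/
  b : SplitQuaternion

namespace SplitOctonion

variable {s : ℝ}

instance : Add (SplitOctonion s) := ⟨fun x y => ⟨x.a + y.a, x.b + y.b⟩⟩

instance : SMul ℝ (SplitOctonion s) := ⟨fun r x => ⟨r • x.a, r • x.b⟩⟩

/-- The unit `e₀`. -/
instance : One (SplitOctonion s) := ⟨⟨1, 0⟩⟩

/-- The Cayley-Dickson product `(a + bl)(c + dl) = (ac + l² d̄ b) + (da + b c̄) l`. -/
instance : Mul (SplitOctonion s) :=
  ⟨fun x y => ⟨x.a * y.a + s • (star y.b * x.b), y.b * x.a + x.b * star y.a⟩⟩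

/-- The conjugation `a + bl ↦ ā - bl`. -/
def conj (x : SplitOctonion s) : SplitOctonion s := ⟨star x.a, -x.b⟩

/-- The coefficient of `e₀`. -/
def re (x : SplitOctonion s) : ℝ := x.a.re

@[simp] lemma add_a (x y : SplitOctonion s) : (x + y).a = x.a + y.a := rfl
@[simp] lemma add_b (x y : SplitOctonion s) : (x + y).b = x.b + y.b := rfl
@[simp] lemma smul_a (r : ℝ) (x : SplitOctonion s) : (r • x).a = r • x.a := rfl
@[simp] lemma smul_b (r : ℝ) (x : SplitOctonion s) : (r • x).b = r • x.b := rfl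
@[simp] lemma one_a : (1 : SplitOctonion s).a = 1 := rfl
@[simp] lemma one_b : (1 : SplitOctonion s).b = 0 := rfl
@[simp] lemma mul_a (x y : SplitOctonion s) :
    (x * y).a = x.a * y.a + s • (star y.b * x.b) := rfl
@[simp] lemma mul_b (x y : SplitOctonion s) :
    (x * y).b = y.b * x.a + x.b * star y.a := rfl

/-- The inner product polarising `N(x) = x x̄`, that is `x ȳ + y x̄ = 2 ⟨x, y⟩ e₀`. -/
def inner (x y : SplitOctonion s) : ℝ := (re (x * conj y) + re (y * conj x)) / 2

end SplitOctonion

/-- `ℝ^{1,2} = Im 𝕌`, with coordinates along `i, j, k`. -/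
abbrev R12 : Type := EuclideanSpace ℝ (Fin 3)

/-- `ℝ^{2,2} = 𝕌`, with coordinates along `1, i, j, k`. -/
abbrev R22 : Type := EuclideanSpace ℝ (Fin 4)

/-- `ℝ^{3,4} = Im 𝔹 = Im 𝕌 ⊕ 𝕌 l`. -/
abbrev ImB : Type := R12 × R22

/-- The identification of `ℝ^{1,2}` with the imaginary split-quaternions. -/
def toImU (x : R12) : SplitQuaternion := ⟨0, x 0, x 1, x 2⟩

/-- The identification of `ℝ^{2,2}` with the split-quaternions. -/
def toU (y : R22) : SplitQuaternion := ⟨y 0, y 1, y 2, y 3⟩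

/-- The inclusion `Im 𝔹 ⊂ 𝔹`, `(x, y) ↦ x + y l`. -/
def toB (s : ℝ) (z : ImB) : SplitOctonion s :=
  ⟨toImU z.1, toU z.2⟩

/-- The imaginary part `𝔹 → Im 𝔹`. -/
def imB {s : ℝ} (x : SplitOctonion s) : ImB :=
  (!₂[x.a.imI, x.a.imJ, x.a.imK], !₂[x.b.re, x.b.imI, x.b.imJ, x.b.imK])

/-- The 2-fold vector cross product `X(a, b) = a b + ⟨a, b⟩ e₀` on `Im 𝔹`. -/
def cross (s : ℝ) (a b : ImB) : ImB :=
  imB (toB s a * toB s b +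
    SplitOctonion.inner (toB s a) (toB s b) • (1 : SplitOctonion s))

/-- The inner product of signature `(1, 2)` on `ℝ^{1,2} = Im 𝕌`, polarising `N(a) = a ā`; it is
the restriction of the inner product of `Im 𝔹`. -/
def inner12 (x y : R12) : ℝ :=
  ((toImU x * star (toImU y)).re + (toImU y * star (toImU x)).re) / 2

/-! ### Almost paracomplex structures -/

section Paracomplex

variable {E H M : Type*} [NormedAddCommGroup E] [NormedSpace ℝ E] [TopologicalSpace H]
  (I : ModelWithCorners ℝ E H) [TopologicalSpace M] [ChartedSpace H M] [IsManifold I ∞ M]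

/-- `V` is smooth on `U` as a vector field, i.e. as a section of the tangent bundle. -/
def SmoothFieldOn (V : ∀ x : M, TangentSpace I x) (U : Set M) : Prop :=
  ContMDiffOn I I.tangent ∞ (fun x => (⟨x, V x⟩ : TangentBundle I M)) U

/-- A smooth field `L` of endomorphisms of the tangent spaces with `L² = id`, whose `±1`-eigenspaces
both have half the dimension of the manifold. -/
structure IsAlmostParacomplex (L : ∀ x : M, TangentSpace I x →ₗ[ℝ] TangentSpace I x) : Prop where
  smooth : ∀ (U : Set M) (V : ∀ x : M, TangentSpace I x), IsOpen U →
    SmoothFieldOn I V U → SmoothFieldOn I (fun x => L x (V x)) U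
  sq_eq : ∀ (x : M) (v : TangentSpace I x), L x (L x v) = v
  finrank_pos : ∀ x : M,
    2 * Module.finrank ℝ (Module.End.eigenspace (L x) 1) = Module.finrank ℝ E
  finrank_neg : ∀ x : M,
    2 * Module.finrank ℝ (Module.End.eigenspace (L x) (-1)) = Module.finrank ℝ E

/-- The Nijenhuis expression
`N_L(V, W) = [LV, LW] - L[LV, W] - L[V, LW] + L²[V, W]` of an endomorphism field. -/
def nijenhuis (L : ∀ x : M, TangentSpace I x →ₗ[ℝ] TangentSpace I x)
    (V W : ∀ x : M, TangentSpace I x) (x : M) : TangentSpace I x :=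
  VectorField.mlieBracket I (fun y => L y (V y)) (fun y => L y (W y)) x
    - L x (VectorField.mlieBracket I (fun y => L y (V y)) W x)
    - L x (VectorField.mlieBracket I V (fun y => L y (W y)) x)
    + L x (L x (VectorField.mlieBracket I V W x))

/-- Integrability: the Nijenhuis tensor vanishes, i.e. `N_L(V, W) = 0` for all (locally defined)
smooth vector fields `V`, `W`. -/
def IsIntegrable (L : ∀ x : M, TangentSpace I x →ₗ[ℝ] TangentSpace I x) : Prop :=
  ∀ (U : Set M) (V W : ∀ x : M, TangentSpace I x), IsOpen U →
    SmoothFieldOn I V U → SmoothFieldOn I W U → ∀ x ∈ U, nijenhuis I L V W x = 0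

/-- The endomorphism field `L_x = -X(ν_x, ·)` on a hypersurface `i : M → Im 𝔹` with unit normal
field `ν`: the linear map `L_x` on `T_x M` with `di (L_x v) = -X(ν_x, di v)`. -/
def inducedEndo (s : ℝ) (i ν : M → ImB) (x : M) : TangentSpace I x →ₗ[ℝ] TangentSpace I x :=
  Classical.epsilon fun L : TangentSpace I x →ₗ[ℝ] TangentSpace I x =>
    ∀ v : TangentSpace I x,
      (show ImB from mfderiv I 𝓘(ℝ, ImB) i x (L v)) =
        -cross s (ν x) (mfderiv I 𝓘(ℝ, ImB) i x v)

end Paracomplex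

/-! ### Oriented Lorentzian surfaces in `ℝ^{1,2}` -/

section Surface

variable {S : Type*} [TopologicalSpace S] [ChartedSpace (EuclideanSpace ℝ (Fin 2)) S]

/-- The differential `df_p : T_p S → ℝ^{1,2}`. -/
def diff (f : S → R12) (p : S) : TangentSpace (𝓡 2) p →L[ℝ] R12 := mfderiv (𝓡 2) 𝓘(ℝ, R12) f p

/-- A smooth immersion of a surface in `ℝ^{1,2}` whose induced metric has signature `(1, 1)`. -/
structure IsLorentzianImmersion (f : S → R12) : Prop where
  contMDiff : ContMDiff (𝓡 2) 𝓘(ℝ, R12) ∞ f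
  injective : ∀ p : S, Function.Injective (diff f p)
  signature : ∀ p : S, ∃ b : Module.Basis (Fin 2) ℝ (TangentSpace (𝓡 2) p),
    inner12 (diff f p (b 0)) (diff f p (b 0)) = 1 ∧
    inner12 (diff f p (b 1)) (diff f p (b 1)) = -1 ∧
    inner12 (diff f p (b 0)) (diff f p (b 1)) = 0

/-- A choice `o` of orientations of the tangent spaces is an orientation of the surface if every
point has an open neighbourhood with a positively oriented smooth frame. -/
def IsOrientation [IsManifold (𝓡 2) ∞ S]
    (o : ∀ p : S, Orientation ℝ (TangentSpace (𝓡 2) p) (Fin 2)) : Prop :=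
  ∀ p : S, ∃ U : Set S, IsOpen U ∧ p ∈ U ∧
    ∃ (e : Fin 2 → ∀ q : S, TangentSpace (𝓡 2) q)
      (he : IsLocalFrameOn (𝓡 2) (EuclideanSpace ℝ (Fin 2)) ∞ e U),
      ∀ (q : S) (hq : q ∈ U), (he.toBasisAt hq).orientation = o q

/-- `n` is a unit time-like normal of `f` at `p` such that `(n, df e₁, df e₂)` is a positively
oriented basis of `ℝ^{1,2}` (oriented by `i, j, k`) for every positively oriented basis `(e₁, e₂)`
of `T_p S`. -/
def IsPositiveUnitNormal (f : S → R12)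
    (o : ∀ p : S, Orientation ℝ (TangentSpace (𝓡 2) p) (Fin 2)) (p : S) (n : R12) : Prop :=
  inner12 n n = -1 ∧
  (∀ v : TangentSpace (𝓡 2) p, inner12 n (diff f p v) = 0) ∧
  ∀ b : Module.Basis (Fin 2) ℝ (TangentSpace (𝓡 2) p), b.orientation = o p →
    0 < (EuclideanSpace.basisFun (Fin 3) ℝ).toBasis.det ![n, diff f p (b 0), diff f p (b 1)]

/-- The positive unit normal (Gauss map) of an oriented Lorentzian surface in `ℝ^{1,2}`. -/
def unitNormal (f : S → R12)
    (o : ∀ p : S, Orientation ℝ (TangentSpace (𝓡 2) p) (Fin 2)) (p : S) : R12 :=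
  Classical.epsilon (IsPositiveUnitNormal f o p)

/-- The coordinate vectors `∂₁, ∂₂` at `p` of the preferred chart at `p`. -/
def coordVec (p : S) (a : Fin 2) : TangentSpace (𝓡 2) p :=
  (EuclideanSpace.single a 1 : EuclideanSpace ℝ (Fin 2))

/-- The first fundamental form `g_{ab} = ⟨∂_a f, ∂_b f⟩` at `p`, in the chart at `p`. -/
def firstForm (f : S → R12) (p : S) : Matrix (Fin 2) (Fin 2) ℝ :=
  Matrix.of fun a b => inner12 (diff f p (coordVec p a)) (diff f p (coordVec p b))

/-- The second fundamental form (configuration tensor) `A(∂_a, ∂_b)` at `p`: the component along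
the normal `n` of the second derivative `∂_a ∂_b f`, in the chart at `p`. -/
def secondForm (f : S → R12)
    (o : ∀ p : S, Orientation ℝ (TangentSpace (𝓡 2) p) (Fin 2)) (p : S) (a b : Fin 2) : R12 :=
  (inner12
    (fderiv ℝ (fderiv ℝ (f ∘ (extChartAt (𝓡 2) p).symm)) (extChartAt (𝓡 2) p p)
      (EuclideanSpace.single a 1) (EuclideanSpace.single b 1)) (unitNormal f o p)
    / inner12 (unitNormal f o p) (unitNormal f o p)) • unitNormal f o p

/-- The mean curvature vector `½ g^{ab} A(∂_a, ∂_b)`, half the metric trace of `A`. -/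
def meanCurvature (f : S → R12)
    (o : ∀ p : S, Orientation ℝ (TangentSpace (𝓡 2) p) (Fin 2)) (p : S) : R12 :=
  (1 / 2 : ℝ) • ∑ a, ∑ b, ((firstForm f p)⁻¹ a b) • secondForm f o p a b

/-- An oriented Lorentzian surface is minimal if its mean curvature vector vanishes. -/
def IsMinimal (f : S → R12)
    (o : ∀ p : S, Orientation ℝ (TangentSpace (𝓡 2) p) (Fin 2)) : Prop :=
  ∀ p : S, meanCurvature f o p = 0

/-! ### The hypersurface `Σ × ℝ^{2,2}` -/

/-- The immersion `f × id : S × ℝ^{2,2} → ℝ^{1,2} × ℝ^{2,2} = Im 𝔹`. -/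
def prodImmersion (f : S → R12) (x : S × R22) : ImB := (f x.1, x.2)

/-- The unit normal `(n, 0)` of `S × ℝ^{2,2}`, the positive one for the product orientation. -/
def prodNormal (f : S → R12)
    (o : ∀ p : S, Orientation ℝ (TangentSpace (𝓡 2) p) (Fin 2)) (x : S × R22) : ImB :=
  (unitNormal f o x.1, 0)

/-- The almost paracomplex structure `L = -X(ν, ·)` of the hypersurface `S × ℝ^{2,2}` of `Im 𝔹`. -/
def prodParacomplex [IsManifold (𝓡 2) ∞ S] (s : ℝ) (f : S → R12)
    (o : ∀ p : S, Orientation ℝ (TangentSpace (𝓡 2) p) (Fin 2)) (x : S × R22) :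
    TangentSpace ((𝓡 2).prod 𝓘(ℝ, R22)) x →ₗ[ℝ] TangentSpace ((𝓡 2).prod 𝓘(ℝ, R22)) x :=
  inducedEndo ((𝓡 2).prod 𝓘(ℝ, R22)) s (prodImmersion f) (prodNormal f o) x

end Surface

end ParaCalabi

end

namespace ParaCalabi

open Set Filter Topology VectorField

noncomputable section

/-! ### Vector fields and brackets seen through a vector-valued map. -/

section DirDeriv

/-! Since `ν = (n, 0)` has no `l`-component, `X(ν, (v, y)) = (n × v, y n)`: the value of `l²` never
enters (`cross_mk_zero`). So `L` acts as `v ↦ -n × v` on the tangent planes of the surface, where it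
is called `J`, and as right multiplication by `-n` on `𝕌`. As `⟨n, n⟩ = -1`, both square to the
identity. Reflecting in a unit tangent vector `e` with `⟨e, e⟩ = 1` and multiplying on the right by
its image gives an injective map anticommuting with `L` (`exists_anticommuting`), so the two
eigenspaces have equal dimension.

For integrability, push the Nijenhuis expression forward by the differential of the immersion `F`.
Because `[V, W]F = V(WF) - W(VF)` (`dirDeriv_mlieBracket`), the terms in second derivatives of `F`
cancel, and only terms with one derivative of `ν` remain (`mfderiv_nijenhuis`).

Write `A = df`, `B = dn`. The `ℝ^{1,2}`-component of what remains vanishes for every surface: it is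
governed by products `B u × A v`, which are multiples of `n`, and by the symmetry of the second
fundamental form. The `ℝ^{2,2}`-component at `(v, y)`, `(w, z)` is `y Q(w) - z Q(v)` with `Q(v) =
B(Jv) + Bv × n` (`mfderiv_nijenhuis_prodParacomplex`). Testing against `y = 0`, `z = 1` shows that
`L` is integrable iff `Q = 0` at every point.

Finally `Q = 0` is minimality. With `B` read as an endomorphism of the tangent plane, `Q` is `BJ +
JB`; as `B` is self-adjoint and `J` is skew, this equals `tr(B) J`. The proof in
`gauss_compatible_iff` phrases it so: the form `⟨Q v, A w⟩` is antisymmetric on a plane, hence a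
single number, and that number is a nonzero multiple of the trace of the second fundamental form. -/

lemma two_le_infty : (2 : WithTop ℕ∞) ≤ ∞ := WithTop.coe_le_coe.2 (le_top : (2 : ℕ∞) ≤ ⊤)

variable {E H M G : Type*} [NormedAddCommGroup E] [NormedSpace ℝ E] [TopologicalSpace H]
  {I : ModelWithCorners ℝ E H} [TopologicalSpace M] [ChartedSpace H M]
  [NormedAddCommGroup G] [NormedSpace ℝ G]

/-- The derivative of a vector valued function `F` along the vector field `V`. -/
def dirDeriv (I : ModelWithCorners ℝ E H) (V : ∀ x : M, TangentSpace I x) (F : M → G) (x : M) : G :=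
  mfderiv I 𝓘(ℝ, G) F x (V x)

/-- The vector field `V` read in the chart at `x`. -/
def chartField (I : ModelWithCorners ℝ E H) (V : ∀ x : M, TangentSpace I x) (x : M) (z : E) : E :=
  mpullback 𝓘(ℝ, E) I (extChartAt I x).symm V z

lemma mfderiv_eq_fderiv_comp_extChartAt_symm [I.Boundaryless] {g : M → G} {x : M}
    (hg : MDifferentiableAt I 𝓘(ℝ, G) g x) (v : E) :
    (show G from mfderiv I 𝓘(ℝ, G) g x v) =
      fderiv ℝ (g ∘ (extChartAt I x).symm) (extChartAt I x x) v := by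
  simp only [mfderiv, hg, writtenInExtChartAt, I.range_eq_univ, fderivWithin_univ]
  rfl

variable [IsManifold I ∞ M]

/-- The derivative along `V` is the fibre component of the tangent map of `F` composed with the
section `V`. -/
lemma contMDiffAt_dirDeriv {V : ∀ x : M, TangentSpace I x} {F : M → G} {x₀ : M}
    (hF : ContMDiff I 𝓘(ℝ, G) ∞ F)
    (hV : ContMDiffAt I I.tangent ∞ (fun x => (⟨x, V x⟩ : TangentBundle I M)) x₀) :
    ContMDiffAt I 𝓘(ℝ, G) ∞ (dirDeriv I V F) x₀ := by
  have h1 : ContMDiff I.tangent 𝓘(ℝ, G).tangent ∞ (tangentMap I 𝓘(ℝ, G) F) :=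
    hF.contMDiff_tangentMap (by simp)
  have h2 := (contMDiff_snd_tangentBundle_modelSpace (n := ∞) G 𝓘(ℝ, G)).comp h1
  exact h2.contMDiffAt.comp x₀ hV

variable [I.Boundaryless]

lemma mfderiv_extChartAt_symm_isInvertible {x : M} {z : E} (hz : z ∈ (extChartAt I x).target) :
    (mfderiv 𝓘(ℝ, E) I (extChartAt I x).symm z).IsInvertible := by
  have : IsManifold I 1 M := IsManifold.of_le (n := ∞) (by simp)
  have h := isInvertible_mfderivWithin_extChartAt_symm (I := I) hz
  rwa [I.range_eq_univ, mfderivWithin_univ] at h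

lemma mdifferentiableAt_extChartAt_symm' {x : M} {z : E} (hz : z ∈ (extChartAt I x).target) :
    MDifferentiableAt 𝓘(ℝ, E) I (extChartAt I x).symm z := by
  have : IsManifold I 1 M := IsManifold.of_le (n := ∞) (by simp)
  have := mdifferentiableWithinAt_extChartAt_symm (I := I) hz
  rwa [I.range_eq_univ, mdifferentiableWithinAt_univ] at this

lemma dirDeriv_extChartAt_symm {F : M → G} (hF : ContMDiff I 𝓘(ℝ, G) ∞ F) (x : M)
    (V : ∀ x : M, TangentSpace I x) {z : E} (hz : z ∈ (extChartAt I x).target) :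
    dirDeriv I V F ((extChartAt I x).symm z) =
      fderiv ℝ (F ∘ (extChartAt I x).symm) z (chartField I V x z) := by
  have h1 := mfderiv_comp_apply (I := 𝓘(ℝ, E)) (I' := I) (I'' := 𝓘(ℝ, G)) z
    (hF.mdifferentiableAt (by simp)) (mdifferentiableAt_extChartAt_symm' hz)
    (mpullback 𝓘(ℝ, E) I (extChartAt I x).symm V z)
  rw [mfderiv_eq_fderiv] at h1
  refine Eq.trans ?_ h1.symm
  have h2 := (mfderiv_extChartAt_symm_isInvertible hz).self_apply_inverse
    (V ((extChartAt I x).symm z))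
  exact congrArg (mfderiv I 𝓘(ℝ, G) F ((extChartAt I x).symm z)) h2.symm

lemma chartField_eq_mfderiv (V : ∀ x : M, TangentSpace I x) (x : M) {y : M}
    (hy : y ∈ (extChartAt I x).source) :
    chartField I V x (extChartAt I x y) = (mfderiv I 𝓘(ℝ, E) (extChartAt I x) y (V y) : E) := by
  have : IsManifold I 1 M := IsManifold.of_le (n := ∞) (by simp)
  -- The point is freed as `y = φ⁻¹ z` so that it can be substituted inside the type of `V y`.
  suffices h : ∀ z ∈ (extChartAt I x).target, ∀ y, y = (extChartAt I x).symm z →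
      chartField I V x z = (mfderiv I 𝓘(ℝ, E) (extChartAt I x) y (V y) : E) from
    h _ ((extChartAt I x).map_source hy) y ((extChartAt I x).left_inv hy).symm
  rintro z hz _ rfl
  have h1 := mfderivWithin_extChartAt_symm_comp_mfderiv_extChartAt (I := I) hz
  rw [I.range_eq_univ, mfderivWithin_univ] at h1
  have h2 := (mfderiv_extChartAt_symm_isInvertible hz).inverse_apply_self
    (mfderiv I 𝓘(ℝ, E) (extChartAt I x) ((extChartAt I x).symm z) (V ((extChartAt I x).symm z)))
  have h3 := DFunLike.congr_fun h1 (V ((extChartAt I x).symm z))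
  exact (congrArg _ h3).symm.trans h2

lemma chartField_self (V : ∀ x : M, TangentSpace I x) (x : M) :
    chartField I V x (extChartAt I x x) = (V x : E) := by
  have : IsManifold I 1 M := IsManifold.of_le (n := ∞) (by simp)
  have h1 := mfderivWithin_extChartAt_symm_inverse_apply (I := I) (V x)
  rw [I.range_eq_univ, mfderivWithin_univ] at h1
  rw [chartField, mpullback_apply]
  have h2 : ∀ y, y = x → (V y : E) = V x := by rintro _ rfl; rfl
  have h3 := h2 _ (extChartAt_to_inv (I := I) x)
  erw [h3]
  exact h1

lemma differentiableAt_chartField [CompleteSpace E] {V : ∀ x : M, TangentSpace I x} {x : M}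
    (hV : ContMDiffAt I I.tangent ∞ (fun x => (⟨x, V x⟩ : TangentBundle I M)) x) :
    DifferentiableAt ℝ (chartField I V x) (extChartAt I x x) := by
  have : IsManifold I 2 M := IsManifold.of_le (n := ∞) two_le_infty
  have h := (hV.mdifferentiableAt (by simp)).mdifferentiableWithinAt (s := univ)
    |>.differentiableWithinAt_mpullbackWithin_vectorField
  simp only [I.range_eq_univ, preimage_univ, inter_univ, mpullbackWithin_univ] at h
  exact differentiableWithinAt_univ.1 h

/-- The differential of the chart at its own centre is the identity, so no transport back is needed.
-/
lemma mlieBracket_eq_lieBracket_chartField (V W : ∀ x : M, TangentSpace I x) (x : M) :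
    (mlieBracket I V W x : E) =
      lieBracket ℝ (chartField I V x) (chartField I W x) (extChartAt I x x) := by
  have : IsManifold I 1 M := IsManifold.of_le (n := ∞) (by simp)
  rw [← mlieBracketWithin_univ, mlieBracketWithin_apply, mfderiv_extChartAt_self]
  simp only [I.range_eq_univ, preimage_univ, inter_univ, mpullbackWithin_univ]
  rw [← lieBracketWithin_univ]
  erw [ContinuousLinearMap.inverse_id]
  rfl

/-- In the chart, `V(WF)` is a Hessian term plus `DF(DW·V)`; the Hessian terms cancel by symmetry
and the rest is `DF` of the bracket. This lets brackets be computed by differentiating vector-valued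
functions. -/
lemma dirDeriv_mlieBracket [CompleteSpace E] {V W : ∀ x : M, TangentSpace I x} {F : M → G} {x : M}
    (hF : ContMDiff I 𝓘(ℝ, G) ∞ F)
    (hV : ContMDiffAt I I.tangent ∞ (fun x => (⟨x, V x⟩ : TangentBundle I M)) x)
    (hW : ContMDiffAt I I.tangent ∞ (fun x => (⟨x, W x⟩ : TangentBundle I M)) x) :
    dirDeriv I (mlieBracket I V W) F x =
      dirDeriv I V (dirDeriv I W F) x - dirDeriv I W (dirDeriv I V F) x := by
  set φ := extChartAt I x with hφ
  set z₀ := φ x with hz₀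
  set F' : E → G := F ∘ φ.symm
  have htarget : φ.target ∈ 𝓝 z₀ := extChartAt_target_mem_nhds x
  have hsm : ContDiffAt ℝ ∞ F' z₀ := by
    have h1 : ContMDiffAt 𝓘(ℝ, E) I ∞ φ.symm z₀ :=
      (contMDiffOn_extChartAt_symm x).contMDiffAt htarget
    exact (hF.contMDiffAt.comp z₀ h1).contDiffAt
  have hd : DifferentiableAt ℝ (fderiv ℝ F') z₀ :=
    (hsm.fderiv_right (m := 1) two_le_infty).differentiableAt (by simp)
  have second : ∀ {U : ∀ x : M, TangentSpace I x} (Y : ∀ x : M, TangentSpace I x),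
      ContMDiffAt I I.tangent ∞ (fun x => (⟨x, U x⟩ : TangentBundle I M)) x →
      dirDeriv I Y (dirDeriv I U F) x =
        fderiv ℝ (fderiv ℝ F') z₀ (chartField I Y x z₀) (chartField I U x z₀) +
        fderiv ℝ F' z₀ (fderiv ℝ (chartField I U x) z₀ (chartField I Y x z₀)) := by
    intro U Y hU
    have e1 : dirDeriv I Y (dirDeriv I U F) x =
        fderiv ℝ (dirDeriv I U F ∘ φ.symm) z₀ (chartField I Y x z₀) := by
      rw [hz₀, hφ, chartField_self]
      exact mfderiv_eq_fderiv_comp_extChartAt_symm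
        ((contMDiffAt_dirDeriv hF hU).mdifferentiableAt (by simp)) (Y x)
    have e2 : dirDeriv I U F ∘ φ.symm =ᶠ[𝓝 z₀]
        fun z => fderiv ℝ F' z (chartField I U x z) := by
      filter_upwards [htarget] with z hz
      exact dirDeriv_extChartAt_symm hF x U hz
    rw [e1, e2.fderiv_eq,
      (hd.hasFDerivAt.clm_apply (differentiableAt_chartField hU).hasFDerivAt).fderiv]
    rw [add_comm]
    rfl
  have e0 : dirDeriv I (mlieBracket I V W) F x = fderiv ℝ F' z₀ (mlieBracket I V W x : E) :=
    mfderiv_eq_fderiv_comp_extChartAt_symm (hF.mdifferentiableAt (by simp)) _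
  have sym : IsSymmSndFDerivAt ℝ F' z₀ := hsm.isSymmSndFDerivAt (by simpa using two_le_infty)
  rw [e0, second _ hW, second _ hV, mlieBracket_eq_lieBracket_chartField, lieBracket_eq, map_sub,
    sym.eq (chartField I V x z₀) (chartField I W x z₀)]
  abel

/-- A vector field is smooth if its image under the differential of an immersion is. -/
lemma contMDiffAt_of_dirDeriv [FiniteDimensional ℝ E] [FiniteDimensional ℝ G]
    {V : ∀ x : M, TangentSpace I x} {F : M → G} {x₀ : M}
    (hF : ContMDiff I 𝓘(ℝ, G) ∞ F) (hi : Function.Injective (mfderiv I 𝓘(ℝ, G) F x₀))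
    (hV : ContMDiffAt I 𝓘(ℝ, G) ∞ (dirDeriv I V F) x₀) :
    ContMDiffAt I I.tangent ∞ (fun x => (⟨x, V x⟩ : TangentBundle I M)) x₀ := by
  have : IsManifold I 1 M := IsManifold.of_le (n := ∞) (by simp)
  have : CompleteSpace E := FiniteDimensional.complete ℝ E
  set φ := extChartAt I x₀ with hφ
  let A : M → E →L[ℝ] G := fun x => fderiv ℝ (F ∘ φ.symm) (φ x)
  have hA : ContMDiffAt I 𝓘(ℝ, E →L[ℝ] G) ∞ A x₀ := by
    have h1 : ContMDiffAt 𝓘(ℝ, E) I ∞ φ.symm (φ x₀) :=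
      (contMDiffOn_extChartAt_symm x₀).contMDiffAt (extChartAt_target_mem_nhds x₀)
    have h2 : ContDiffAt ℝ ∞ (F ∘ φ.symm) (φ x₀) := (hF.contMDiffAt.comp _ h1).contDiffAt
    exact (h2.fderiv_right (m := ∞) (by simp)).contMDiffAt.comp x₀ contMDiffAt_extChartAt
  have hAV : ∀ᶠ x in 𝓝 x₀, A x (chartField I V x₀ (φ x)) = dirDeriv I V F x := by
    filter_upwards [extChartAt_source_mem_nhds (I := I) x₀] with x hx
    have := dirDeriv_extChartAt_symm hF x₀ V (φ.map_source hx)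
    rw [φ.left_inv hx] at this
    exact this.symm
  have hA0 : Function.Injective (A x₀) := by
    intro u v huv
    apply hi
    have h := mfderiv_eq_fderiv_comp_extChartAt_symm (hF.mdifferentiableAt (by simp) (x := x₀))
    exact (h u).trans (huv.trans (h v).symm)
  -- A left inverse of the differential at `x₀` makes `P ∘ A` the identity there, hence invertible
  -- nearby; the field is then recovered as `(P A)⁻¹ P (dF V)`, a smooth expression.
  obtain ⟨P, hP⟩ : ∃ P : G →L[ℝ] E, ∀ v, P (A x₀ v) = v := by
    obtain ⟨P, hP⟩ := (A x₀ : E →ₗ[ℝ] G).exists_leftInverse_of_injective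
      (LinearMap.ker_eq_bot.2 hA0)
    exact ⟨LinearMap.toContinuousLinearMap P, fun v => LinearMap.congr_fun hP v⟩
  let B : M → E →L[ℝ] E := fun x => P ∘L A x
  have hB : ContMDiffAt I 𝓘(ℝ, E →L[ℝ] E) ∞ B x₀ := contMDiffAt_const.clm_comp hA
  have hB0 : B x₀ = ContinuousLinearMap.id ℝ E := by ext v; exact hP v
  have hBi : ContDiffAt ℝ ∞ ContinuousLinearMap.inverse (B x₀) := by
    have := contDiffAt_map_inverse (𝕜 := ℝ) (n := ∞) (ContinuousLinearEquiv.refl ℝ E)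
    rw [hB0]; exact this
  have hBinv : ∀ᶠ x in 𝓝 x₀, (B x).IsInvertible := by
    have h1 : {C : E →L[ℝ] E | C.IsInvertible} ∈ 𝓝 (B x₀) := by
      rw [hB0]; exact ContinuousLinearEquiv.nhds (ContinuousLinearEquiv.refl ℝ E)
    exact hB.continuousAt h1
  have hsol : ContMDiffAt I 𝓘(ℝ, E) ∞ (fun x => (B x).inverse (P (dirDeriv I V F x))) x₀ :=
    (hBi.contMDiffAt.comp x₀ hB).clm_apply (P.contMDiff.contMDiffAt.comp x₀ hV)
  have hc : ContMDiffAt I 𝓘(ℝ, E) ∞ (fun x => chartField I V x₀ (φ x)) x₀ := by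
    refine hsol.congr_of_eventuallyEq ?_
    filter_upwards [hAV, hBinv] with x h1 h2
    rw [← h1]
    exact (h2.inverse_apply_self (chartField I V x₀ (φ x))).symm
  refine (Bundle.contMDiffAt_section (IB := I) (F := E) (E := TangentSpace I) x₀).2 ?_
  refine hc.congr_of_eventuallyEq ?_
  filter_upwards [extChartAt_source_mem_nhds (I := I) x₀] with x hx
  have hx' : x ∈ (chartAt H x₀).source := by rwa [extChartAt_source] at hx
  refine Eq.trans ?_ (chartField_eq_mfderiv V x₀ hx).symm
  rw [← TangentBundle.continuousLinearMapAt_trivializationAt hx']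
  exact (Bundle.Trivialization.continuousLinearMapAt_apply_of_mem
    (trivializationAt E (TangentSpace I) x₀) (R := ℝ) (by simpa using hx') (V x)).symm

end DirDeriv

/-! ### The Nijenhuis expression of an endomorphism field induced by a cross product. -/

section Nijenhuis

variable {E H M G : Type*} [NormedAddCommGroup E] [NormedSpace ℝ E] [TopologicalSpace H]
  {I : ModelWithCorners ℝ E H} [TopologicalSpace M] [ChartedSpace H M]
  [NormedAddCommGroup G] [NormedSpace ℝ G]

lemma dirDeriv_clm_apply₂ (X : G →L[ℝ] G →L[ℝ] G) {ν g : M → G} {x : M}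
    (Y : ∀ x : M, TangentSpace I x)
    (hν : MDifferentiableAt I 𝓘(ℝ, G) ν x) (hg : MDifferentiableAt I 𝓘(ℝ, G) g x) :
    dirDeriv I Y (fun y => -X (ν y) (g y)) x =
      -(X (dirDeriv I Y ν x) (g x) + X (ν x) (dirDeriv I Y g x)) := by
  have h1 : HasFDerivWithinAt (ν ∘ (extChartAt I x).symm) (mfderiv I 𝓘(ℝ, G) ν x : E →L[ℝ] G)
    (range I) (extChartAt I x x) := hν.hasMFDerivAt.2
  have h2 : HasFDerivWithinAt (g ∘ (extChartAt I x).symm) (mfderiv I 𝓘(ℝ, G) g x : E →L[ℝ] G)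
    (range I) (extChartAt I x x) := hg.hasMFDerivAt.2
  have h3 := (X.hasFDerivWithinAt_of_bilinear h1 h2).neg
  have hc : ContinuousAt (fun y => -X (ν y) (g y)) x :=
    ((X.continuous.continuousAt.comp hν.continuousAt).clm_apply hg.continuousAt).neg
  have h4 : HasMFDerivAt I 𝓘(ℝ, G) (fun y => -X (ν y) (g y)) x _ := ⟨hc, h3⟩
  have h5 := congrArg (fun T : TangentSpace I x →L[ℝ] G => T (Y x)) h4.mfderiv
  refine h5.trans ?_
  simp only [Function.comp_apply, extChartAt_to_inv]
  rw [add_comm]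
  rfl

variable [IsManifold I ∞ M] [I.Boundaryless] [CompleteSpace E]

/-- The Nijenhuis expression of an endomorphism field `L` with `dF (L v) = -X(ν, dF v)` involves
only the first derivative of `ν`. -/
lemma mfderiv_nijenhuis (X : G →L[ℝ] G →L[ℝ] G) {F ν : M → G}
    {L : ∀ x : M, TangentSpace I x →ₗ[ℝ] TangentSpace I x} {x : M}
    {V W : ∀ x : M, TangentSpace I x}
    (hF : ContMDiff I 𝓘(ℝ, G) ∞ F)
    (hL : ∀ y (v : TangentSpace I y),
      (mfderiv I 𝓘(ℝ, G) F y (L y v) : G) = -X (ν y) (mfderiv I 𝓘(ℝ, G) F y v))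
    (hsq : ∀ v, L x (L x v) = v)
    (hν : MDifferentiableAt I 𝓘(ℝ, G) ν x)
    (hV : ContMDiffAt I I.tangent ∞ (fun x => (⟨x, V x⟩ : TangentBundle I M)) x)
    (hW : ContMDiffAt I I.tangent ∞ (fun x => (⟨x, W x⟩ : TangentBundle I M)) x)
    (hLV : ContMDiffAt I I.tangent ∞ (fun x => (⟨x, L x (V x)⟩ : TangentBundle I M)) x)
    (hLW : ContMDiffAt I I.tangent ∞ (fun x => (⟨x, L x (W x)⟩ : TangentBundle I M)) x) :
    (mfderiv I 𝓘(ℝ, G) F x (nijenhuis I L V W x) : G) =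
      -X (mfderiv I 𝓘(ℝ, G) ν x (L x (V x))) (mfderiv I 𝓘(ℝ, G) F x (W x))
      + X (mfderiv I 𝓘(ℝ, G) ν x (L x (W x))) (mfderiv I 𝓘(ℝ, G) F x (V x))
      + X (ν x) (X (mfderiv I 𝓘(ℝ, G) ν x (W x)) (mfderiv I 𝓘(ℝ, G) F x (V x))
        - X (mfderiv I 𝓘(ℝ, G) ν x (V x)) (mfderiv I 𝓘(ℝ, G) F x (W x))) := by
  have hD : ∀ U : ∀ x : M, TangentSpace I x,
      dirDeriv I (fun y => L y (U y)) F = fun y => -X (ν y) (dirDeriv I U F y) :=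
    fun U => funext fun y => hL y (U y)
  have hdV := (contMDiffAt_dirDeriv hF hV).mdifferentiableAt (by simp)
  have hdW := (contMDiffAt_dirDeriv hF hW).mdifferentiableAt (by simp)
  have b1 := dirDeriv_mlieBracket hF hLV hLW
  have b2 := dirDeriv_mlieBracket hF hLV hW
  have b3 := dirDeriv_mlieBracket hF hV hLW
  rw [hD W, hD V, dirDeriv_clm_apply₂ X _ hν hdW, dirDeriv_clm_apply₂ X _ hν hdV] at b1
  rw [hD V, dirDeriv_clm_apply₂ X _ hν hdV] at b2
  rw [hD W, dirDeriv_clm_apply₂ X _ hν hdW] at b3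
  have c2 := congrFun (hD (mlieBracket I (fun y => L y (V y)) W)) x
  have c3 := congrFun (hD (mlieBracket I V (fun y => L y (W y)))) x
  simp only [b2, b3] at c2 c3
  have c4 := congrFun (hD (fun y => L y (V y))) x
  -- `L² = id` pushed forward: `X(ν, X(ν, ·))` is the identity on vectors tangent to the immersion.
  have c5 : ∀ U : ∀ x : M, TangentSpace I x,
      X (ν x) (X (ν x) (dirDeriv I U F x)) = dirDeriv I U F x := by
    intro U
    have h1 := congrFun (hD fun y => L y (U y)) x
    simp only [congrFun (hD U) x, map_neg, neg_neg] at h1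
    rw [← h1]
    exact congrArg (mfderiv I 𝓘(ℝ, G) F x) (hsq (U x))
  have hN : (mfderiv I 𝓘(ℝ, G) F x (nijenhuis I L V W x) : G) =
      dirDeriv I (mlieBracket I (fun y => L y (V y)) (fun y => L y (W y))) F x
      - dirDeriv I (fun z => L z (mlieBracket I (fun y => L y (V y)) W z)) F x
      - dirDeriv I (fun z => L z (mlieBracket I V (fun y => L y (W y)) z)) F x
      + dirDeriv I (mlieBracket I V W) F x := by
    simp only [nijenhuis, hsq, map_add, map_sub]
    rfl
  rw [hN, b1, c2, c3]
  -- `V(WF)` and `W(VF)` need not be tangent separately, but their difference is `[V, W]F`, to which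
  -- `c5` applies. This removes the last second derivatives.
  have c6 := c5 (mlieBracket I V W)
  rw [dirDeriv_mlieBracket hF hV hW] at c6 ⊢
  simp only [map_sub, map_add, map_neg] at c6 ⊢
  rw [← c6]
  simp only [dirDeriv]
  abel

end Nijenhuis

/-! ### Products of imaginary split-quaternions and their action on `𝕌`. -/

section Algebra

/-- The cross product of `ℝ^{1,2}`: the imaginary part of the product of `Im 𝕌`. -/
def cross12 (u v : R12) : R12 :=
  !₂[u 2 * v 1 - u 1 * v 2, u 2 * v 0 - u 0 * v 2, u 0 * v 1 - u 1 * v 0]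

/-- Right multiplication of `𝕌 = ℝ^{2,2}` by `Im 𝕌 = ℝ^{1,2}`. -/
def mulRight (y : R22) (m : R12) : R22 :=
  !₂[-(y 1 * m 0) + y 2 * m 1 + y 3 * m 2, y 0 * m 0 - y 2 * m 2 + y 3 * m 1,
    y 0 * m 1 - y 1 * m 2 + y 3 * m 0, y 0 * m 2 + y 1 * m 1 - y 2 * m 0]

lemma inner12_eq (u v : R12) : inner12 u v = u 0 * v 0 - u 1 * v 1 - u 2 * v 2 := by
  simp [inner12, toImU]
  ring

lemma inner12_comm (u v : R12) : inner12 u v = inner12 v u := by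
  simp only [inner12_eq]; ring

/-- In the Cayley-Dickson product `l²` multiplies only the product of the two `l`-components, and
here the left factor has none. Hence both signs of `l²` give the same `L`. -/
lemma cross_mk_zero (s : ℝ) (m v : R12) (y : R22) :
    cross s (m, 0) (v, y) = (cross12 m v, mulRight y m) := by
  ext i <;> fin_cases i <;>
    simp [cross, imB, toB, toImU, toU, cross12, mulRight] <;> ring

lemma cross12_add_left (u u' v : R12) : cross12 (u + u') v = cross12 u v + cross12 u' v := by
  ext i; fin_cases i <;> simp [cross12] <;> ring

lemma cross12_add_right (u v v' : R12) : cross12 u (v + v') = cross12 u v + cross12 u v' := by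
  ext i; fin_cases i <;> simp [cross12] <;> ring

lemma cross12_smul_left (r : ℝ) (u v : R12) : cross12 (r • u) v = r • cross12 u v := by
  ext i; fin_cases i <;> simp [cross12] <;> ring

lemma cross12_smul_right (r : ℝ) (u v : R12) : cross12 u (r • v) = r • cross12 u v := by
  ext i; fin_cases i <;> simp [cross12] <;> ring

lemma cross12_swap (u v : R12) : cross12 u v = -cross12 v u := by
  ext i; fin_cases i <;> simp [cross12] <;> ring

lemma mulRight_add_left (y y' : R22) (m : R12) :
    mulRight (y + y') m = mulRight y m + mulRight y' m := by
  ext i; fin_cases i <;> simp [mulRight] <;> ring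

lemma mulRight_add_right (y : R22) (m m' : R12) :
    mulRight y (m + m') = mulRight y m + mulRight y m' := by
  ext i; fin_cases i <;> simp [mulRight] <;> ring

lemma mulRight_smul_left (r : ℝ) (y : R22) (m : R12) :
    mulRight (r • y) m = r • mulRight y m := by
  ext i; fin_cases i <;> simp [mulRight] <;> ring

lemma mulRight_smul_right (r : ℝ) (y : R22) (m : R12) :
    mulRight y (r • m) = r • mulRight y m := by
  ext i; fin_cases i <;> simp [mulRight] <;> ring

/-- `inner12` as a continuous bilinear map. -/
def inner12L : R12 →L[ℝ] R12 →L[ℝ] ℝ :=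
  LinearMap.toContinuousBilinearMap (LinearMap.mk₂ ℝ inner12
    (fun _ _ _ => by simp [inner12_eq]; ring) (fun _ _ _ => by simp [inner12_eq]; ring)
    (fun _ _ _ => by simp [inner12_eq]; ring) (fun _ _ _ => by simp [inner12_eq]; ring))

@[simp] lemma inner12L_apply (u v : R12) : inner12L u v = inner12 u v := rfl

/-- `cross12` as a continuous bilinear map. -/
def cross12L : R12 →L[ℝ] R12 →L[ℝ] R12 :=
  LinearMap.toContinuousBilinearMap (LinearMap.mk₂ ℝ cross12
    cross12_add_left cross12_smul_left cross12_add_right (fun r u v => cross12_smul_right r u v))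

@[simp] lemma cross12L_apply (u v : R12) : cross12L u v = cross12 u v := rfl

/-- The cross product `(m, z) ↦ X((m, 0), z)` of `Im 𝔹` by elements of `ℝ^{1,2}`, extended by zero
to a continuous bilinear map on `Im 𝔹`. -/
def crossL : ImB →L[ℝ] ImB →L[ℝ] ImB :=
  LinearMap.toContinuousBilinearMap (LinearMap.mk₂ ℝ
    (fun a b : ImB => ((cross12 a.1 b.1, mulRight b.2 a.1) : ImB))
    (fun _ _ _ => by simp [cross12_add_left, mulRight_add_right])
    (fun _ _ _ => by simp [cross12_smul_left, mulRight_smul_right])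
    (fun _ _ _ => by simp [cross12_add_right, mulRight_add_left])
    (fun _ _ _ => by simp [cross12_smul_right, mulRight_smul_left]))

@[simp] lemma crossL_apply (a b : ImB) : crossL a b = (cross12 a.1 b.1, mulRight b.2 a.1) := rfl

lemma inner12_add_left (u v w : R12) : inner12 (u + v) w = inner12 u w + inner12 v w := by
  simp [inner12_eq]; ring

lemma inner12_add_right (u v w : R12) : inner12 u (v + w) = inner12 u v + inner12 u w := by
  simp [inner12_eq]; ring

lemma inner12_smul_left (r : ℝ) (u v : R12) : inner12 (r • u) v = r * inner12 u v := by
  simp [inner12_eq]; ring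

lemma inner12_smul_right (r : ℝ) (u v : R12) : inner12 u (r • v) = r * inner12 u v := by
  simp [inner12_eq]; ring

lemma inner12_neg_left (u v : R12) : inner12 (-u) v = -inner12 u v := by
  simp [inner12_eq]; ring

lemma inner12_neg_right (u v : R12) : inner12 u (-v) = -inner12 u v := by
  simp [inner12_eq]; ring

lemma inner12_zero_left (u : R12) : inner12 0 u = 0 := by simp [inner12_eq]

lemma cross12_cross12 (u v w : R12) :
    cross12 u (cross12 v w) = inner12 u w • v - inner12 u v • w := by
  ext i; fin_cases i <;> simp [cross12, inner12_eq] <;> ring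

lemma cross12_self (u : R12) : cross12 u u = 0 := by
  ext i; fin_cases i <;> simp [cross12] <;> ring

lemma inner12_cross12_left (u v : R12) : inner12 (cross12 u v) u = 0 := by
  simp [cross12, inner12_eq]; ring

lemma inner12_cross12_right (u v : R12) : inner12 (cross12 u v) v = 0 := by
  simp [cross12, inner12_eq]; ring

lemma inner12_cross12_cyclic (u v w : R12) :
    inner12 (cross12 u v) w = inner12 u (cross12 v w) := by
  simp [cross12, inner12_eq]; ring

lemma inner12_cross12_self (u v : R12) :
    inner12 (cross12 u v) (cross12 u v) = inner12 u u * inner12 v v - inner12 u v ^ 2 := by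
  simp [cross12, inner12_eq]; ring

/-- The minus sign reflects `jk = -i` in `𝕌`: the product is opposite to the orientation `(i, j,
k)`. -/
lemma det_basisFun (n u v : R12) :
    (EuclideanSpace.basisFun (Fin 3) ℝ).toBasis.det ![n, u, v] = -inner12 (cross12 u v) n := by
  rw [Module.Basis.det_apply, Matrix.det_fin_three]
  simp [Module.Basis.toMatrix_apply, cross12, inner12_eq]
  ring

/-- Associativity of `𝕌`, together with `pq = p × q - ⟨p, q⟩` for imaginary `p`, `q`. -/
lemma mulRight_mulRight (y : R22) (p q : R12) :
    mulRight (mulRight y p) q = mulRight y (cross12 p q) - inner12 p q • y := by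
  ext i; fin_cases i <;> simp [cross12, inner12_eq, mulRight] <;> ring

lemma mulRight_one (m : R12) : mulRight !₂[1, 0, 0, 0] m = !₂[0, m 0, m 1, m 2] := by
  ext i; fin_cases i <;> simp [mulRight]

lemma eq_zero_of_mulRight_one {m : R12} (h : mulRight !₂[1, 0, 0, 0] m = 0) : m = 0 := by
  rw [mulRight_one] at h
  ext i
  fin_cases i
  · simpa using congrArg (fun y : R22 => y 1) h
  · simpa using congrArg (fun y : R22 => y 2) h
  · simpa using congrArg (fun y : R22 => y 3) h

end Algebra

/-! ### Pointwise algebra of a surface with its Gauss map. -/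

section Gauss

/-- Expand `n × (n × w)` by the double product formula. -/
lemma eq_smul_of_cross12_eq_zero {n w : R12} (hn : inner12 n n = -1) (h : cross12 n w = 0) :
    w = (-inner12 n w) • n := by
  have h1 := cross12_cross12 n n w
  rw [h, hn] at h1
  have h2 : cross12 n 0 = 0 := by simpa using cross12_smul_right 0 n 0
  rw [h2, neg_one_smul, sub_neg_eq_add] at h1
  rw [neg_smul]
  exact eq_neg_of_add_eq_zero_right h1.symm

lemma cross12_eq_smul {n u v : R12} (hn : inner12 n n = -1) (hu : inner12 n u = 0)
    (hv : inner12 n v = 0) : cross12 u v = (-inner12 n (cross12 u v)) • n :=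
  eq_smul_of_cross12_eq_zero hn (by rw [cross12_cross12, hu, hv]; simp)

lemma cross12_cross12_normal {n v : R12} (hn : inner12 n n = -1) (hv : inner12 n v = 0) :
    cross12 n (cross12 n v) = v := by
  rw [cross12_cross12, hn, hv]; simp

/-- `u × (a × b)` vanishes and `a × b` is a nonzero multiple of `n`, so `n × u = 0`; applying `n ×`
again returns `u`. This is nondegeneracy of the metric on the plane spanned by `a` and `b`. -/
lemma eq_zero_of_inner12_eq_zero {n a b u : R12} (hn : inner12 n n = -1) (ha : inner12 n a = 0)
    (hb : inner12 n b = 0) (hab : cross12 a b ≠ 0) (hu : inner12 n u = 0)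
    (hua : inner12 u a = 0) (hub : inner12 u b = 0) : u = 0 := by
  have h1 := cross12_eq_smul hn ha hb
  have hk : inner12 n (cross12 a b) ≠ 0 := by
    intro h; rw [h] at h1; exact hab (by simpa using h1)
  have h2 : cross12 u (cross12 a b) = 0 := by rw [cross12_cross12, hua, hub]; simp
  rw [h1, cross12_smul_right, smul_eq_zero] at h2
  have h3 := h2.resolve_left (neg_ne_zero.2 hk)
  rw [cross12_swap, neg_eq_zero] at h3
  rw [← cross12_cross12_normal hn hu, h3]
  simpa using cross12_smul_right 0 n 0

variable {T : Type*} [AddCommGroup T] [Module ℝ T]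

lemma cross12_map_basis (A : T →ₗ[ℝ] R12) (b : Module.Basis (Fin 2) ℝ T) (v w : T) :
    cross12 (A v) (A w) = b.det ![v, w] • cross12 (A (b 0)) (A (b 1)) := by
  conv_lhs => rw [← b.sum_repr v, ← b.sum_repr w]
  rw [Module.Basis.det_apply, Matrix.det_fin_two]
  simp only [Fin.sum_univ_two, map_add, map_smul, cross12_add_left, cross12_add_right,
    cross12_smul_left, cross12_smul_right, cross12_self, cross12_swap (A (b 1)) (A (b 0)),
    Module.Basis.toMatrix_apply, Matrix.cons_val_zero, Matrix.cons_val_one]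
  module

/-- The first order data of a Lorentzian surface in `ℝ^{1,2}` at a point: the differential `A` of
the immersion, the unit normal `n` and the differential `B` of the Gauss map. -/
structure IsGaussData (A B : T →ₗ[ℝ] R12) (n : R12) : Prop where
  injective : Function.Injective A
  inner_self : inner12 n n = -1
  inner_tangent : ∀ v, inner12 n (A v) = 0
  exists_eq : ∀ u, inner12 n u = 0 → ∃ v, A v = u
  inner_gauss : ∀ v, inner12 n (B v) = 0
  symm : ∀ u v, inner12 (B u) (A v) = inner12 (B v) (A u)

variable {A B : T →ₗ[ℝ] R12} {n : R12} {J : T → T}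

namespace IsGaussData

/-- Both sides are multiples of `n`, and the coefficient is governed by `⟨B(Jv), A(Jw)⟩`, which is
symmetric in `v` and `w`. -/
lemma cross_gauss (h : IsGaussData A B n) (hJ : ∀ v, A (J v) = -cross12 n (A v)) (v w : T) :
    cross12 (B (J v)) (A w) = cross12 (B (J w)) (A v) := by
  have key : ∀ v w, inner12 n (cross12 (B (J v)) (A w)) = inner12 (B (J v)) (A (J w)) := by
    intro v w
    rw [inner12_comm, inner12_cross12_cyclic, cross12_swap, hJ]
  rw [cross12_eq_smul h.inner_self (h.inner_gauss (J v)) (h.inner_tangent w),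
    cross12_eq_smul h.inner_self (h.inner_gauss (J w)) (h.inner_tangent v), key, key, h.symm]

lemma cross_cross_gauss (h : IsGaussData A B n) (v w : T) :
    cross12 n (cross12 (B v) (A w)) = 0 := by
  rw [cross12_cross12, h.inner_gauss, h.inner_tangent]; simp

/-- If the product vanished, all products of tangent vectors would. Pairing `A v` with `n × A v`
then makes every tangent vector null; polarising, `A v` is orthogonal to all of `n^⊥` and to `n`, so
`A = 0`. -/
lemma cross_basis_ne_zero (h : IsGaussData A B n) (b : Module.Basis (Fin 2) ℝ T) :
    cross12 (A (b 0)) (A (b 1)) ≠ 0 := by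
  intro h0
  have h2 : ∀ v w, cross12 (A v) (A w) = 0 := fun v w => by
    rw [cross12_map_basis A b, h0, smul_zero]
  have h3 : ∀ v, inner12 (A v) (A v) = 0 := by
    intro v
    obtain ⟨w, hw⟩ := h.exists_eq (cross12 n (A v))
      (by rw [inner12_comm]; exact inner12_cross12_left n (A v))
    have h4 := h2 v w
    rw [hw, cross12_cross12, inner12_comm (A v) n, h.inner_tangent, zero_smul, sub_zero,
      smul_eq_zero] at h4
    rcases h4 with h4 | h4
    · exact h4
    · have := h.inner_self
      rw [h4, inner12_zero_left] at this
      norm_num at this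
  have h5 : ∀ v, A v = 0 := by
    intro v
    have hn := h.inner_self
    have hv := h.inner_tangent v
    obtain ⟨w, hw⟩ := h.exists_eq (cross12 n (A v))
      (by rw [inner12_comm]; exact inner12_cross12_left n (A v))
    have h6 := h2 v w
    rw [hw, cross12_cross12, h3 v, zero_smul, inner12_comm, hv] at h6
    have h7 : ∀ u, inner12 (A v) u = 0 := by
      intro u
      -- As `⟨n, n⟩ = -1`, the projection of `u` to `n^⊥` adds `⟨n, u⟩ n`.
      obtain ⟨w, hw⟩ := h.exists_eq (u + inner12 n u • n) (by
        rw [inner12_add_right, inner12_smul_right, hn]; ring)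
      have h8 := h3 (v + w)
      rw [map_add, inner12_add_left, inner12_add_right, inner12_add_right, h3, h3,
        inner12_comm (A w)] at h8
      have h9 : inner12 (A v) (A w) = 0 := by linarith
      rw [hw, inner12_add_right, inner12_smul_right, inner12_comm (A v) n, hv] at h9
      linarith
    ext i
    fin_cases i
    · simpa [inner12_eq] using h7 !₂[1, 0, 0]
    · simpa [inner12_eq] using h7 !₂[0, 1, 0]
    · simpa [inner12_eq] using h7 !₂[0, 0, 1]
  have h6 := h.injective ((h5 (b 0)).trans (map_zero A).symm)
  exact b.ne_zero 0 h6

/-- The trace of the second fundamental form vanishes iff the Gauss map is compatible with the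
paracomplex structures. -/
lemma gauss_compatible_iff (h : IsGaussData A B n) (hJ : ∀ v, A (J v) = -cross12 n (A v))
    (b : Module.Basis (Fin 2) ℝ T) :
    (∀ v, B (J v) + cross12 (B v) n = 0) ↔
      inner12 (A (b 1)) (A (b 1)) * inner12 (B (b 0)) (A (b 0))
        - 2 * inner12 (A (b 0)) (A (b 1)) * inner12 (B (b 0)) (A (b 1))
        + inner12 (A (b 0)) (A (b 0)) * inner12 (B (b 1)) (A (b 1)) = 0 := by
  have hn := h.inner_self
  have hc := cross12_eq_smul hn (h.inner_tangent (b 0)) (h.inner_tangent (b 1))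
  have hc0 := h.cross_basis_ne_zero b
  set κ := -inner12 n (cross12 (A (b 0)) (A (b 1)))
  have hκ : κ ≠ 0 := by
    rintro h0; rw [h0, zero_smul] at hc; exact hc0 hc
  -- With `A b₀ × A b₁ = κ n`, the operator `κ J` becomes a double cross product, so its matrix in
  -- `b` consists of metric coefficients.
  have hJA : ∀ v, κ • A (J v) = cross12 (A v) (cross12 (A (b 0)) (A (b 1))) := by
    intro v
    rw [hc, cross12_smul_right, hJ, ← cross12_swap]
  have hJ0 : κ • J (b 0) = inner12 (A (b 0)) (A (b 1)) • b 0
      - inner12 (A (b 0)) (A (b 0)) • b 1 := by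
    apply h.injective
    rw [map_smul, hJA, cross12_cross12]
    simp
  have hJ1 : κ • J (b 1) = inner12 (A (b 1)) (A (b 1)) • b 0
      - inner12 (A (b 0)) (A (b 1)) • b 1 := by
    apply h.injective
    rw [map_smul, hJA, cross12_cross12, inner12_comm (A (b 1)) (A (b 0))]
    simp
  have hQ : ∀ v w, inner12 (B (J v) + cross12 (B v) n) (A w) =
      inner12 (B (J v)) (A w) - inner12 (B v) (A (J w)) := by
    intro v w
    rw [inner12_add_left, inner12_cross12_cyclic, hJ, inner12_neg_right, sub_neg_eq_add]
  have hQn : ∀ v, inner12 n (B (J v) + cross12 (B v) n) = 0 := by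
    intro v
    rw [inner12_add_right, h.inner_gauss, inner12_comm n, inner12_cross12_right, add_zero]
  have hβ : κ * (inner12 (B (J (b 0))) (A (b 1)) - inner12 (B (b 0)) (A (J (b 1)))) =
      -(inner12 (A (b 1)) (A (b 1)) * inner12 (B (b 0)) (A (b 0))
        - 2 * inner12 (A (b 0)) (A (b 1)) * inner12 (B (b 0)) (A (b 1))
        + inner12 (A (b 0)) (A (b 0)) * inner12 (B (b 1)) (A (b 1))) := by
    rw [mul_sub, ← inner12_smul_left, ← inner12_smul_right, ← map_smul, ← map_smul, hJ0, hJ1]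
    simp only [sub_eq_add_neg, ← neg_smul, map_add, map_smul, inner12_add_left, inner12_add_right,
      inner12_smul_left, inner12_smul_right]
    ring
  -- Antisymmetry of `⟨Q v, A w⟩` is the symmetry of the second fundamental form; only the entry at
  -- `(b 0, b 1)` can be nonzero.
  have hanti : ∀ v w, inner12 (B (J v)) (A w) - inner12 (B v) (A (J w)) =
      -(inner12 (B (J w)) (A v) - inner12 (B w) (A (J v))) := by
    intro v w
    rw [h.symm (J v) w, h.symm v (J w)]; ring
  have hself : ∀ v, inner12 (B (J v)) (A v) - inner12 (B v) (A (J v)) = 0 := by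
    intro v; linarith [hanti v v]
  constructor
  · intro hz
    have h1 := hQ (b 0) (b 1)
    rw [hz, inner12_zero_left] at h1
    rw [← h1, mul_zero] at hβ
    linarith
  · intro hz
    rw [hz, neg_zero, mul_eq_zero] at hβ
    have h01 := hβ.resolve_left hκ
    have hb : ∀ i, B (J (b i)) + cross12 (B (b i)) n = 0 := by
      intro i
      refine eq_zero_of_inner12_eq_zero hn (h.inner_tangent (b 0)) (h.inner_tangent (b 1)) hc0
        (hQn _) ?_ ?_
      · rw [hQ]; fin_cases i
        · exact hself _
        · exact (hanti _ _).trans (by simp [h01])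
      · rw [hQ]; fin_cases i
        · exact h01
        · exact hself _
    have hJlin : ∀ v, J v = b.repr v 0 • J (b 0) + b.repr v 1 • J (b 1) := by
      intro v
      apply h.injective
      rw [map_add, map_smul, map_smul, hJ, hJ, hJ]
      conv_lhs => rw [← b.sum_repr v]
      simp only [Fin.sum_univ_two, map_add, map_smul, cross12_add_right, cross12_smul_right]
      module
    intro v
    have h0 := hb 0
    have h1 := hb 1
    have hv : B v = b.repr v 0 • B (b 0) + b.repr v 1 • B (b 1) := by
      conv_lhs => rw [← b.sum_repr v]
      simp only [Fin.sum_univ_two, map_add, map_smul]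
    rw [hJlin v, hv]
    simp only [map_add, map_smul, cross12_add_left, cross12_smul_left]
    calc _ = b.repr v 0 • (B (J (b 0)) + cross12 (B (b 0)) n)
          + b.repr v 1 • (B (J (b 1)) + cross12 (B (b 1)) n) := by module
      _ = 0 := by rw [h0, h1]; simp

end IsGaussData

end Gauss

/-! ### The unit normal, the Weingarten equation and mean curvature. -/

section Surface

variable {S : Type*} [TopologicalSpace S] [ChartedSpace (EuclideanSpace ℝ (Fin 2)) S]
  {f : S → R12} {o : ∀ p : S, Orientation ℝ (TangentSpace (𝓡 2) p) (Fin 2)} {p : S}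

/-- The unit time-like multiple of `a × b`. -/
def normalizedCross (a b : R12) : R12 :=
  (√(-inner12 (cross12 a b) (cross12 a b)))⁻¹ • cross12 a b

/-- `⟨a × b, a × b⟩` is the Gram determinant: it is `-1` in an orthonormal frame, and a change of
basis multiplies it by a square. -/
lemma IsLorentzianImmersion.inner12_cross12_neg (hf : IsLorentzianImmersion f)
    (b : Module.Basis (Fin 2) ℝ (TangentSpace (𝓡 2) p)) :
    inner12 (cross12 (diff f p (b 0)) (diff f p (b 1)))
      (cross12 (diff f p (b 0)) (diff f p (b 1))) < 0 := by
  obtain ⟨e, h0, h1, h01⟩ := hf.signature p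
  have he : cross12 (diff f p (e 0)) (diff f p (e 1)) =
      b.det ![e 0, e 1] • cross12 (diff f p (b 0)) (diff f p (b 1)) :=
    cross12_map_basis (diff f p : TangentSpace (𝓡 2) p →ₗ[ℝ] R12) b (e 0) (e 1)
  have h2 := inner12_cross12_self (diff f p (e 0)) (diff f p (e 1))
  rw [h0, h1, h01, he, inner12_smul_left, inner12_smul_right] at h2
  by_contra h3
  have h4 := mul_nonneg (mul_self_nonneg (b.det ![e 0, e 1])) (not_lt.1 h3)
  linarith

/-- A normal satisfies `a × b = κ n`; the orientation condition says `κ > 0`, and `κ² = -⟨a × b, a ×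
b⟩` then fixes it. One positive basis suffices, since passing to another multiplies `a × b` by a
positive determinant. -/
lemma IsLorentzianImmersion.isPositiveUnitNormal_iff (hf : IsLorentzianImmersion f)
    (b : Module.Basis (Fin 2) ℝ (TangentSpace (𝓡 2) p)) (hb : b.orientation = o p) (n : R12) :
    IsPositiveUnitNormal f o p n ↔ n = normalizedCross (diff f p (b 0)) (diff f p (b 1)) := by
  have hneg := hf.inner12_cross12_neg b
  set c := cross12 (diff f p (b 0)) (diff f p (b 1)) with hc
  have hsq : √(-inner12 c c) ^ 2 = -inner12 c c := Real.sq_sqrt (by linarith)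
  have hpos : 0 < √(-inner12 c c) := Real.sqrt_pos.2 (by linarith)
  constructor
  · rintro ⟨hn, ht, hd⟩
    have h1 := cross12_eq_smul hn (ht (b 0)) (ht (b 1))
    have h2 := hd b hb
    rw [det_basisFun, inner12_comm] at h2
    obtain ⟨κ, hκ, h3⟩ : ∃ κ : ℝ, 0 < κ ∧ c = κ • n := ⟨_, h2, h1⟩
    have h4 : inner12 c c = -κ ^ 2 := by
      rw [h3, inner12_smul_left, inner12_smul_right, hn]; ring
    rw [normalizedCross, ← hc, h4, neg_neg, Real.sqrt_sq hκ.le, h3, smul_smul,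
      inv_mul_cancel₀ hκ.ne', one_smul]
  · rintro rfl
    refine ⟨?_, ?_, ?_⟩
    · rw [normalizedCross, inner12_smul_left, inner12_smul_right, ← hc]
      field_simp
      linarith
    · intro v
      have hv : diff f p v = b.repr v 0 • diff f p (b 0) + b.repr v 1 • diff f p (b 1) := by
        conv_lhs => rw [← b.sum_repr v]
        simp only [Fin.sum_univ_two, map_add, map_smul]
      rw [normalizedCross, inner12_smul_left, hv, inner12_add_right, inner12_smul_right,
        inner12_smul_right, inner12_cross12_left, inner12_cross12_right]
      simp
    · intro b' hb'
      have h1 : 0 < b.det b' := (b.orientation_eq_iff_det_pos b').1 (hb.trans hb'.symm)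
      have h2 : cross12 (diff f p (b' 0)) (diff f p (b' 1)) = b.det ![b' 0, b' 1] • c :=
        cross12_map_basis (diff f p : TangentSpace (𝓡 2) p →ₗ[ℝ] R12) b (b' 0) (b' 1)
      have h3 : ![b' 0, b' 1] = b' := by ext i; fin_cases i <;> rfl
      rw [h3] at h2
      rw [det_basisFun, h2, normalizedCross, ← hc, inner12_smul_left, inner12_smul_right,
        ← mul_assoc, ← mul_neg]
      exact mul_pos (mul_pos h1 (inv_pos.2 hpos)) (by linarith)

lemma IsLorentzianImmersion.unitNormal_eq (hf : IsLorentzianImmersion f)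
    (b : Module.Basis (Fin 2) ℝ (TangentSpace (𝓡 2) p)) (hb : b.orientation = o p) :
    unitNormal f o p = normalizedCross (diff f p (b 0)) (diff f p (b 1)) :=
  (hf.isPositiveUnitNormal_iff b hb _).1 (Classical.epsilon_spec (p := IsPositiveUnitNormal f o p)
    ⟨_, (hf.isPositiveUnitNormal_iff b hb _).2 rfl⟩)

lemma IsLorentzianImmersion.unitNormal_spec (hf : IsLorentzianImmersion f)
    (o : ∀ p : S, Orientation ℝ (TangentSpace (𝓡 2) p) (Fin 2)) (p : S) :
    IsPositiveUnitNormal f o p (unitNormal f o p) := by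
  obtain ⟨e, -⟩ := hf.signature p
  have hb := e.orientation_adjustToOrientation (o p)
  exact (hf.isPositiveUnitNormal_iff _ hb _).2 (hf.unitNormal_eq _ hb)

lemma IsLorentzianImmersion.exists_diff_eq (hf : IsLorentzianImmersion f) {u : R12}
    (hu : inner12 (unitNormal f o p) u = 0) : ∃ v, diff f p v = u := by
  obtain ⟨e, h0, h1, h01⟩ := hf.signature p
  obtain ⟨hn, ht, -⟩ := hf.unitNormal_spec o p
  have hc : cross12 (diff f p (e 0)) (diff f p (e 1)) ≠ 0 := by
    intro h
    have := hf.inner12_cross12_neg e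
    rw [h, inner12_zero_left] at this
    exact this.ne rfl
  -- Expansion of `u` in the orthonormal frame; the minus sign is `⟨e₁, e₁⟩ = -1`.
  refine ⟨inner12 u (diff f p (e 0)) • e 0 - inner12 u (diff f p (e 1)) • e 1, ?_⟩
  rw [← sub_eq_zero, map_sub, map_smul, map_smul]
  have h10 : inner12 (diff f p (e 1)) (diff f p (e 0)) = 0 := by rw [inner12_comm, h01]
  refine eq_zero_of_inner12_eq_zero hn (ht (e 0)) (ht (e 1)) hc ?_ ?_ ?_ <;>
  simp only [sub_eq_add_neg, inner12_add_left, inner12_add_right,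
    inner12_neg_left, inner12_neg_right, inner12_smul_left, inner12_smul_right, h0, h1, h01, h10,
    ht, hu] <;> ring

variable [IsManifold (𝓡 2) ∞ S]

/-- Near each point the normal is the normalised cross product of an oriented smooth frame, whose
radicand stays positive. -/
lemma IsLorentzianImmersion.contMDiff_unitNormal (hf : IsLorentzianImmersion f)
    (ho : IsOrientation o) : ContMDiff (𝓡 2) 𝓘(ℝ, R12) ∞ (unitNormal f o) := by
  intro p
  obtain ⟨U, hU, hpU, e, he, heo⟩ := ho p
  have ha : ∀ i, ContMDiffAt (𝓡 2) 𝓘(ℝ, R12) ∞ (dirDeriv (𝓡 2) (e i) f) p := fun i =>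
    contMDiffAt_dirDeriv hf.contMDiff (he.contMDiffAt hU hpU i)
  have hc : ContMDiffAt (𝓡 2) 𝓘(ℝ, R12) ∞
      (fun q => cross12 (dirDeriv (𝓡 2) (e 0) f q) (dirDeriv (𝓡 2) (e 1) f q)) p :=
    (cross12L.contMDiff.contMDiffAt.comp p (ha 0)).clm_apply (ha 1)
  have hcc := (inner12L.contMDiff.contMDiffAt.comp p hc).clm_apply hc
  have hb : ∀ q (hq : q ∈ U) i, he.toBasisAt hq i = e i q := fun q hq i => he.toBasisAt_coe hq i
  have hneg : inner12 (cross12 (dirDeriv (𝓡 2) (e 0) f p) (dirDeriv (𝓡 2) (e 1) f p))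
      (cross12 (dirDeriv (𝓡 2) (e 0) f p) (dirDeriv (𝓡 2) (e 1) f p)) < 0 := by
    have := hf.inner12_cross12_neg (he.toBasisAt hpU)
    rwa [hb, hb] at this
  have hcd : ContDiffAt ℝ ∞ (fun t : ℝ => (√(-t))⁻¹)
      (inner12 (cross12 (dirDeriv (𝓡 2) (e 0) f p) (dirDeriv (𝓡 2) (e 1) f p))
      (cross12 (dirDeriv (𝓡 2) (e 0) f p) (dirDeriv (𝓡 2) (e 1) f p))) :=
    (contDiffAt_id.neg.sqrt (by simpa using hneg.ne)).inv
      (Real.sqrt_pos.2 (by simpa using hneg)).ne'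
  have hfin : ContMDiffAt (𝓡 2) 𝓘(ℝ, R12) ∞ (fun q =>
      normalizedCross (dirDeriv (𝓡 2) (e 0) f q) (dirDeriv (𝓡 2) (e 1) f q)) p :=
    (ContMDiffAt.comp p (hcd.contMDiffAt) hcc).smul hc
  refine hfin.congr_of_eventuallyEq ?_
  filter_upwards [hU.mem_nhds hpU] with q hq
  have := hf.unitNormal_eq (he.toBasisAt hq) (heo q hq)
  rwa [hb, hb] at this

/-- The differential of the Gauss map. -/
def diffNormal (f : S → R12) (o : ∀ p : S, Orientation ℝ (TangentSpace (𝓡 2) p) (Fin 2)) (p : S) :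
    TangentSpace (𝓡 2) p →L[ℝ] R12 := mfderiv (𝓡 2) 𝓘(ℝ, R12) (unitNormal f o) p

/-- Weingarten's equation: differentiate `⟨n, ∂_v f⟩ = 0` along `u`. -/
lemma IsLorentzianImmersion.inner12_fderiv_fderiv (hf : IsLorentzianImmersion f)
    (ho : IsOrientation o) (p : S) (u v : TangentSpace (𝓡 2) p) :
    inner12 (fderiv ℝ (fderiv ℝ (f ∘ (extChartAt (𝓡 2) p).symm)) (extChartAt (𝓡 2) p p) u v)
      (unitNormal f o p) = -inner12 (diffNormal f o p u) (diff f p v) := by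
  set φ := extChartAt (𝓡 2) p with hφ
  have ht : φ.target ∈ 𝓝 (φ p) := extChartAt_target_mem_nhds p
  have hs : ContMDiffAt 𝓘(ℝ, EuclideanSpace ℝ (Fin 2)) (𝓡 2) ∞ φ.symm (φ p) :=
    (contMDiffOn_extChartAt_symm p).contMDiffAt ht
  have hF : ContDiffAt ℝ ∞ (f ∘ φ.symm) (φ p) := (hf.contMDiff.contMDiffAt.comp _ hs).contDiffAt
  have hn := hf.contMDiff_unitNormal ho
  have hN : ContDiffAt ℝ ∞ (unitNormal f o ∘ φ.symm) (φ p) :=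
    (hn.contMDiffAt.comp _ hs).contDiffAt
  have hd : DifferentiableAt ℝ (fderiv ℝ (f ∘ φ.symm)) (φ p) :=
    (hF.fderiv_right (m := 1) two_le_infty).differentiableAt (by simp)
  have e1 := inner12L.hasFDerivAt_of_bilinear (hN.differentiableAt (by simp)).hasFDerivAt
    (hd.hasFDerivAt.clm_apply (hasFDerivAt_const (v : EuclideanSpace ℝ (Fin 2)) (φ p)))
  have e2 : (fun z => inner12L ((unitNormal f o ∘ φ.symm) z)
      (fderiv ℝ (f ∘ φ.symm) z (v : EuclideanSpace ℝ (Fin 2)))) =ᶠ[𝓝 (φ p)] fun _ => 0 := by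
    filter_upwards [ht] with z hz
    have h1 := mfderiv_comp_apply (I := 𝓘(ℝ, EuclideanSpace ℝ (Fin 2))) (I' := 𝓡 2)
      (I'' := 𝓘(ℝ, R12)) z (hf.contMDiff.mdifferentiableAt (by simp))
      (mdifferentiableAt_extChartAt_symm' hz) (v : EuclideanSpace ℝ (Fin 2))
    rw [mfderiv_eq_fderiv] at h1
    refine (congrArg (inner12 (unitNormal f o (φ.symm z))) h1).trans ?_
    exact (hf.unitNormal_spec o (φ.symm z)).2.1 _
  have e3 := (e1.congr_of_eventuallyEq e2.symm).unique (hasFDerivAt_const 0 (φ p))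
  have e4 : inner12 (unitNormal f o (φ.symm (φ p)))
      (fderiv ℝ (f ∘ φ.symm) (φ p) 0 + fderiv ℝ (fderiv ℝ (f ∘ φ.symm)) (φ p) u v) +
      inner12 (fderiv ℝ (unitNormal f o ∘ φ.symm) (φ p) u)
        (fderiv ℝ (f ∘ φ.symm) (φ p) v) = 0 :=
    congrArg (fun T : EuclideanSpace ℝ (Fin 2) →L[ℝ] ℝ => T u) e3
  rw [map_zero, zero_add, hφ, extChartAt_to_inv] at e4
  have dN : diffNormal f o p u = fderiv ℝ (unitNormal f o ∘ φ.symm) (φ p) u :=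
    mfderiv_eq_fderiv_comp_extChartAt_symm (hn.mdifferentiableAt (by simp)) u
  have dF : diff f p v = fderiv ℝ (f ∘ φ.symm) (φ p) v :=
    mfderiv_eq_fderiv_comp_extChartAt_symm (hf.contMDiff.mdifferentiableAt (by simp)) v
  rw [dN, dF, inner12_comm]
  exact eq_neg_of_add_eq_zero_left e4

/-- Differentiate `⟨n, n⟩ = -1`. -/
lemma IsLorentzianImmersion.inner12_diffNormal (hf : IsLorentzianImmersion f)
    (ho : IsOrientation o) (p : S) (v : TangentSpace (𝓡 2) p) :
    inner12 (unitNormal f o p) (diffNormal f o p v) = 0 := by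
  set φ := extChartAt (𝓡 2) p with hφ
  have hn := hf.contMDiff_unitNormal ho
  have hs : ContMDiffAt 𝓘(ℝ, EuclideanSpace ℝ (Fin 2)) (𝓡 2) ∞ φ.symm (φ p) :=
    (contMDiffOn_extChartAt_symm p).contMDiffAt (extChartAt_target_mem_nhds p)
  have hN : ContDiffAt ℝ ∞ (unitNormal f o ∘ φ.symm) (φ p) :=
    (hn.contMDiffAt.comp _ hs).contDiffAt
  have e0 := (hN.differentiableAt (by simp)).hasFDerivAt
  have e1 := inner12L.hasFDerivAt_of_bilinear e0 e0
  have e2 : (fun z => inner12L ((unitNormal f o ∘ φ.symm) z) ((unitNormal f o ∘ φ.symm) z)) =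
      fun _ => -1 := funext fun z => (hf.unitNormal_spec o (φ.symm z)).1
  rw [e2] at e1
  have e3 := e1.unique (hasFDerivAt_const (-1) (φ p))
  have e4 : inner12 (unitNormal f o (φ.symm (φ p)))
      (fderiv ℝ (unitNormal f o ∘ φ.symm) (φ p) v) +
      inner12 (fderiv ℝ (unitNormal f o ∘ φ.symm) (φ p) v) (unitNormal f o (φ.symm (φ p))) = 0 :=
    congrArg (fun T : EuclideanSpace ℝ (Fin 2) →L[ℝ] ℝ => T v) e3
  have dN : diffNormal f o p v = fderiv ℝ (unitNormal f o ∘ φ.symm) (φ p) v :=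
    mfderiv_eq_fderiv_comp_extChartAt_symm (hn.mdifferentiableAt (by simp)) v
  rw [← dN, inner12_comm _ (unitNormal f o (φ.symm (φ p))), hφ, extChartAt_to_inv] at e4
  linarith

lemma IsLorentzianImmersion.isGaussData (hf : IsLorentzianImmersion f) (ho : IsOrientation o)
    (p : S) : IsGaussData (diff f p : TangentSpace (𝓡 2) p →ₗ[ℝ] R12)
      (diffNormal f o p : TangentSpace (𝓡 2) p →ₗ[ℝ] R12) (unitNormal f o p) where
  injective := hf.injective p
  inner_self := (hf.unitNormal_spec o p).1
  inner_tangent := (hf.unitNormal_spec o p).2.1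
  exists_eq _ hu := hf.exists_diff_eq hu
  inner_gauss := hf.inner12_diffNormal ho p
  symm u v := by
    have h1 := hf.inner12_fderiv_fderiv ho p u v
    have h2 := hf.inner12_fderiv_fderiv ho p v u
    have hs : ContMDiffAt 𝓘(ℝ, EuclideanSpace ℝ (Fin 2)) (𝓡 2) ∞ (extChartAt (𝓡 2) p).symm
        (extChartAt (𝓡 2) p p) :=
      (contMDiffOn_extChartAt_symm p).contMDiffAt (extChartAt_target_mem_nhds p)
    have hF : ContDiffAt ℝ ∞ (f ∘ (extChartAt (𝓡 2) p).symm) (extChartAt (𝓡 2) p p) :=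
      (hf.contMDiff.contMDiffAt.comp _ hs).contDiffAt
    have hsym := (hF.isSymmSndFDerivAt (by simpa using two_le_infty)).eq u v
    have h3 := h1.symm.trans ((congrArg (inner12 · (unitNormal f o p)) hsym).trans h2)
    exact neg_injective h3

/-- The coordinate basis of the tangent space at `p`. -/
def coordBasis (p : S) : Module.Basis (Fin 2) ℝ (TangentSpace (𝓡 2) p) :=
  (EuclideanSpace.basisFun (Fin 2) ℝ).toBasis

omit [IsManifold (𝓡 2) ∞ S] in
lemma coordBasis_apply (p : S) (a : Fin 2) : coordBasis p a = coordVec p a := by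
  change (EuclideanSpace.basisFun (Fin 2) ℝ).toBasis a = _
  simp [coordVec]

/-- Cramer's rule for the inverse of `g` turns the metric trace into the numerator in
`gauss_compatible_iff` divided by `det g`, which is nonzero. -/
lemma IsLorentzianImmersion.meanCurvature_eq_zero_iff (hf : IsLorentzianImmersion f)
    (ho : IsOrientation o) {J : TangentSpace (𝓡 2) p → TangentSpace (𝓡 2) p}
    (hJ : ∀ v, diff f p (J v) = -cross12 (unitNormal f o p) (diff f p v)) :
    meanCurvature f o p = 0 ↔
      ∀ v, diffNormal f o p (J v) + cross12 (diffNormal f o p v) (unitNormal f o p) = 0 := by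
  have h := hf.isGaussData ho p
  refine Iff.trans ?_ (h.gauss_compatible_iff hJ (coordBasis p)).symm
  have hn := h.inner_self
  have hn0 : unitNormal f o p ≠ 0 := by
    intro h0; rw [h0, inner12_zero_left] at hn; norm_num at hn
  -- The minus sign of Weingarten's equation cancels against `⟨n, n⟩ = -1`.
  have hsec : ∀ a b, secondForm f o p a b =
      inner12 (diffNormal f o p (coordVec p a)) (diff f p (coordVec p b)) • unitNormal f o p := by
    intro a b
    have h1 := hf.inner12_fderiv_fderiv ho p (coordVec p a) (coordVec p b)
    have h2 : inner12 (fderiv ℝ (fderiv ℝ (f ∘ (extChartAt (𝓡 2) p).symm)) (extChartAt (𝓡 2) p p)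
      (EuclideanSpace.single a 1) (EuclideanSpace.single b 1)) (unitNormal f o p) =
      -inner12 (diffNormal f o p (coordVec p a)) (diff f p (coordVec p b)) := h1
    rw [secondForm, h2, hn, neg_div_neg_eq, div_one]
  have hneg := hf.inner12_cross12_neg (coordBasis p)
  rw [inner12_cross12_self, coordBasis_apply, coordBasis_apply] at hneg
  have hcomm := inner12_comm (diff f p (coordVec p 1)) (diff f p (coordVec p 0))
  have hsymm := h.symm (coordVec p 1) (coordVec p 0)
  simp only [ContinuousLinearMap.coe_coe] at hsymm ⊢
  rw [coordBasis_apply, coordBasis_apply]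
  have hdet : (firstForm f p).det =
      inner12 (diff f p (coordVec p 0)) (diff f p (coordVec p 0)) *
      inner12 (diff f p (coordVec p 1)) (diff f p (coordVec p 1)) -
      inner12 (diff f p (coordVec p 0)) (diff f p (coordVec p 1)) ^ 2 := by
    rw [Matrix.det_fin_two]
    simp only [firstForm, Matrix.of_apply, hcomm]
    ring
  have key : meanCurvature f o p = ((1 / 2) * (firstForm f p).det⁻¹ *
      (inner12 (diff f p (coordVec p 1)) (diff f p (coordVec p 1)) *
        inner12 (diffNormal f o p (coordVec p 0)) (diff f p (coordVec p 0))
        - 2 * inner12 (diff f p (coordVec p 0)) (diff f p (coordVec p 1)) *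
        inner12 (diffNormal f o p (coordVec p 0)) (diff f p (coordVec p 1))
        + inner12 (diff f p (coordVec p 0)) (diff f p (coordVec p 0)) *
        inner12 (diffNormal f o p (coordVec p 1)) (diff f p (coordVec p 1)))) •
      unitNormal f o p := by
    rw [meanCurvature, Matrix.inv_def, Matrix.adjugate_fin_two, Ring.inverse_eq_inv']
    simp only [Fin.sum_univ_two, hsec, Matrix.smul_apply, Matrix.of_apply, Matrix.cons_val_zero,
      Matrix.cons_val_one, Matrix.cons_val', Matrix.cons_val_fin_one, smul_eq_mul, hsymm]
    simp only [firstForm, Matrix.of_apply, hcomm]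
    module
  have hdet0 : (firstForm f p).det ≠ 0 := by rw [hdet]; exact hneg.ne
  rw [key, smul_eq_zero_iff_left hn0]
  simp [hdet0]

end Surface

/-! ### Involutions, reflections and the dimension of eigenspaces. -/

section LinearAlgebra

lemma exists_linearMap_comp_eq {T W : Type*} [AddCommGroup T] [Module ℝ T] [AddCommGroup W]
    [Module ℝ W] (A : T →ₗ[ℝ] W) (hA : Function.Injective A) (R : W →ₗ[ℝ] W)
    (h : ∀ v, ∃ w, A w = R (A v)) : ∃ L : T →ₗ[ℝ] T, ∀ v, A (L v) = R (A v) := by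
  let e := LinearEquiv.ofInjective A hA
  refine ⟨e.symm.toLinearMap ∘ₗ (R ∘ₗ A).codRestrict (LinearMap.range A) h, fun v => ?_⟩
  have h1 := e.apply_symm_apply ((R ∘ₗ A).codRestrict (LinearMap.range A) h v)
  exact congrArg Subtype.val h1

/-- The eigenspaces of an involution which anticommutes with an injective endomorphism have half
the dimension. -/
lemma two_mul_finrank_eigenspace {T : Type*} [AddCommGroup T] [Module ℝ T]
    [FiniteDimensional ℝ T] {L P : T →ₗ[ℝ] T} (hL : ∀ v, L (L v) = v)
    (hP : Function.Injective P) (hPL : ∀ v, P (L v) = -L (P v)) :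
    2 * Module.finrank ℝ (Module.End.eigenspace L 1) = Module.finrank ℝ T ∧
      2 * Module.finrank ℝ (Module.End.eigenspace L (-1)) = Module.finrank ℝ T := by
  have hcompl : IsCompl (Module.End.eigenspace L (1 : ℝ)) (Module.End.eigenspace L (-1)) := by
    refine ⟨Submodule.disjoint_def.2 fun v h1 h2 => ?_, codisjoint_iff_le_sup.2 fun v _ => ?_⟩
    · rw [Module.End.mem_eigenspace_iff] at h1 h2
      rw [h1, one_smul, neg_one_smul] at h2
      have h3 : (2 : ℝ) • v = 0 := by rw [two_smul]; nth_rewrite 1 [h2]; exact neg_add_cancel v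
      exact (smul_eq_zero.1 h3).resolve_left two_ne_zero
    · refine Submodule.mem_sup.2 ⟨(1 / 2 : ℝ) • (v + L v), ?_, (1 / 2 : ℝ) • (v - L v), ?_, ?_⟩
      · rw [Module.End.mem_eigenspace_iff, map_smul, map_add, hL, one_smul, add_comm]
      · rw [Module.End.mem_eigenspace_iff, map_smul, map_sub, hL]; module
      · module
  -- `P` embeds the `μ`-eigenspace in the `-μ`-eigenspace; using both signs gives equality of
  -- dimensions.
  have hle : ∀ μ : ℝ, Module.finrank ℝ (Module.End.eigenspace L μ) ≤
      Module.finrank ℝ (Module.End.eigenspace L (-μ)) := by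
    intro μ
    rw [(Submodule.equivMapOfInjective P hP (Module.End.eigenspace L μ)).finrank_eq]
    refine Submodule.finrank_mono ?_
    rintro _ ⟨v, hv, rfl⟩
    have hv' : L v = μ • v := Module.End.mem_eigenspace_iff.1 hv
    rw [Module.End.mem_eigenspace_iff, eq_comm, neg_smul, neg_eq_iff_eq_neg, ← hPL, hv', map_smul]
  have hsum := Submodule.finrank_add_eq_of_isCompl hcompl
  have h1 := hle 1
  have h2 := hle (-1)
  rw [neg_neg] at h2
  omega

/-- The part of `u` orthogonal to `a` is sent by `n ×` to a multiple of `a`, as `a ×` kills the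
image. It supplies the anticommutation of `n ×` with the reflection in `a`. -/
lemma cross12_reflection {n a u : R12} (hna : inner12 n a = 0)
    (ha : inner12 a a = 1) :
    cross12 n (u - inner12 u a • a) = inner12 (cross12 n u) a • a := by
  set w := cross12 n (u - inner12 u a • a) with hw
  have h1 : cross12 a w = 0 := by
    rw [hw, cross12_cross12, inner12_comm a n, hna, zero_smul, sub_zero, sub_eq_add_neg,
      ← neg_smul, inner12_add_right, inner12_smul_right, ha, inner12_comm u a]
    simp
  have h2 := cross12_cross12 a a w
  have h3 : cross12 a 0 = 0 := by simpa using cross12_smul_right 0 a 0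
  rw [h1, h3, ha, one_smul] at h2
  rw [← sub_eq_zero.1 h2.symm]
  congr 1
  rw [hw, sub_eq_add_neg, ← neg_smul, cross12_add_right, cross12_smul_right, inner12_add_right,
    inner12_smul_right, inner12_comm a (cross12 n a), inner12_cross12_right, inner12_comm]
  ring

lemma mulRight_nijenhuis {n p q : R12} (y z : R22) (p' q' : R12) (hp : inner12 n p = 0)
    (hq : inner12 n q = 0) :
    -mulRight z p' + mulRight y q' + mulRight (mulRight y q - mulRight z p) n =
      mulRight y (q' + cross12 q n) - mulRight z (p' + cross12 p n) := by
  rw [sub_eq_add_neg (mulRight y q), ← neg_one_smul ℝ (mulRight z p), mulRight_add_left,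
    mulRight_smul_left, mulRight_mulRight, mulRight_mulRight, inner12_comm p, inner12_comm q, hp, hq,
    mulRight_add_right, mulRight_add_right]
  module

/-- On the surface factor, reflection in `e` reverses the orientation of the plane and so
anticommutes with `n ×`. On `𝕌`, right multiplications by the orthogonal vectors `D e` and `n`
anticommute, and `(D e)² = -1` gives injectivity. -/
lemma exists_anticommuting {T : Type*} [AddCommGroup T] [Module ℝ T] {D : T →ₗ[ℝ] R12}
    (hD : Function.Injective D) {e : T} {n : R12} (he : inner12 (D e) (D e) = 1)
    (ht : ∀ v, inner12 n (D v) = 0) {L : T × R22 →ₗ[ℝ] T × R22}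
    (hL1 : ∀ v, D (L v).1 = -cross12 n (D v.1)) (hL2 : ∀ v, (L v).2 = -mulRight v.2 n) :
    ∃ P : T × R22 →ₗ[ℝ] T × R22, Function.Injective P ∧ ∀ v, P (L v) = -L (P v) := by
  let P : T × R22 →ₗ[ℝ] T × R22 :=
    { toFun := fun v => (v.1 - (2 * inner12 (D v.1) (D e)) • e, mulRight v.2 (D e))
      map_add' := fun v w => by
        refine Prod.ext ?_ (mulRight_add_left _ _ _)
        simp only [Prod.fst_add, map_add, inner12_add_left]
        module
      map_smul' := fun r v => by
        refine Prod.ext ?_ (mulRight_smul_left _ _ _)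
        simp only [Prod.smul_fst, map_smul, inner12_smul_left, RingHom.id_apply]
        module }
  have hP1 : ∀ v, D (P v).1 = D v.1 - (2 * inner12 (D v.1) (D e)) • D e := fun v => by
    simp [P]
  have hP2 : ∀ v, (P v).2 = mulRight v.2 (D e) := fun v => rfl
  refine ⟨P, (injective_iff_map_eq_zero P).2 fun v hv => ?_, fun v => Prod.ext (hD ?_) ?_⟩
  · have h1 := hP1 v
    have h2 := hP2 v
    rw [hv, Prod.fst_zero, map_zero] at h1
    rw [hv, Prod.snd_zero] at h2
    have h4 := congrArg (inner12 · (D e)) h1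
    simp only [inner12_zero_left, sub_eq_add_neg, ← neg_smul, inner12_add_left, inner12_smul_left,
      he] at h4
    have h5 : inner12 (D v.1) (D e) = 0 := by linarith
    rw [h5, mul_zero, zero_smul, sub_zero] at h1
    refine Prod.ext (hD (h1.symm.trans (map_zero D).symm)) ?_
    have h6 := mulRight_mulRight v.2 (D e) (D e)
    have h0 : mulRight 0 (D e) = 0 := by simpa using mulRight_smul_left 0 0 (D e)
    have h0' : mulRight v.2 0 = 0 := by simpa using mulRight_smul_right 0 v.2 0
    rw [← h2, cross12_self, he, h0, h0', one_smul, zero_sub] at h6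
    exact neg_eq_zero.1 h6.symm
  · have hr := cross12_reflection (u := D v.1) (ht e) he
    rw [hP1, Prod.fst_neg, map_neg, hL1, hL1, hP1, neg_neg]
    simp only [sub_eq_add_neg, ← neg_smul, cross12_add_right, cross12_smul_right] at hr ⊢
    rw [← neg_one_smul ℝ (cross12 n (D v.1)), inner12_smul_left]
    linear_combination (norm := module) (-2 : ℝ) • hr
  · rw [hP2, Prod.snd_neg, hL2, hL2, hP2, neg_neg, ← neg_one_smul ℝ (mulRight v.2 n),
      mulRight_smul_left, mulRight_mulRight, mulRight_mulRight, cross12_swap (D e) n,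
      inner12_comm (D e) n, ht, ← neg_one_smul ℝ (cross12 n (D e)), mulRight_smul_right]
    module

end LinearAlgebra

/-! ### The hypersurface `Σ × ℝ^{2,2}`. -/

section Product

variable {S : Type*} [TopologicalSpace S] [ChartedSpace (EuclideanSpace ℝ (Fin 2)) S]
  {f : S → R12} {o : ∀ p : S, Orientation ℝ (TangentSpace (𝓡 2) p) (Fin 2)}

/-- The target carries the vector-space model `𝓘(ℝ, G × G')`, not the product model, because `ImB`
serves as one vector space. -/
lemma hasMFDerivAt_prodMk_space {E H M G G' : Type*} [NormedAddCommGroup E] [NormedSpace ℝ E]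
    [TopologicalSpace H] {I : ModelWithCorners ℝ E H} [TopologicalSpace M] [ChartedSpace H M]
    [NormedAddCommGroup G] [NormedSpace ℝ G] [NormedAddCommGroup G'] [NormedSpace ℝ G']
    {g : M → G} {g' : M → G'} {x : M} {A : E →L[ℝ] G} {A' : E →L[ℝ] G'}
    (h : HasMFDerivAt I 𝓘(ℝ, G) g x A) (h' : HasMFDerivAt I 𝓘(ℝ, G') g' x A') :
    HasMFDerivAt I 𝓘(ℝ, G × G') (fun y => (g y, g' y)) x (A.prod A') :=
  ⟨h.1.prodMk h'.1, HasFDerivWithinAt.prodMk h.2 h'.2⟩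

lemma mfderiv_prodImmersion (hf : IsLorentzianImmersion f) (x : S × R22)
    (v : EuclideanSpace ℝ (Fin 2) × R22) :
    (mfderiv ((𝓡 2).prod 𝓘(ℝ, R22)) 𝓘(ℝ, ImB) (prodImmersion f) x v : ImB) =
      (diff f x.1 v.1, v.2) := by
  have h1 := (hf.contMDiff.mdifferentiableAt (by simp) (x := x.1)).hasMFDerivAt.comp x
    (hasMFDerivAt_fst (I := 𝓡 2) (I' := 𝓘(ℝ, R22)) x)
  have h2 := hasMFDerivAt_snd (I := 𝓡 2) (I' := 𝓘(ℝ, R22)) x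
  have h3 := (hasMFDerivAt_prodMk_space h1 h2).mfderiv
  exact congrArg (fun T : EuclideanSpace ℝ (Fin 2) × R22 →L[ℝ] ImB => T v) h3

lemma contMDiff_prodImmersion (hf : IsLorentzianImmersion f) :
    ContMDiff ((𝓡 2).prod 𝓘(ℝ, R22)) 𝓘(ℝ, ImB) ∞ (prodImmersion f) :=
  (hf.contMDiff.comp contMDiff_fst).prodMk_space contMDiff_snd

lemma mfderiv_prodImmersion_injective (hf : IsLorentzianImmersion f) (x : S × R22) :
    Function.Injective
      (mfderiv ((𝓡 2).prod 𝓘(ℝ, R22)) 𝓘(ℝ, ImB) (prodImmersion f) x) := by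
  intro v w hvw
  have h := ((mfderiv_prodImmersion hf x v).symm.trans hvw).trans (mfderiv_prodImmersion hf x w)
  obtain ⟨h1, h2⟩ := Prod.ext_iff.1 h
  exact Prod.ext (hf.injective x.1 h1) h2

variable [IsManifold (𝓡 2) ∞ S]

lemma mfderiv_prodNormal (hf : IsLorentzianImmersion f) (ho : IsOrientation o) (x : S × R22)
    (v : EuclideanSpace ℝ (Fin 2) × R22) :
    (mfderiv ((𝓡 2).prod 𝓘(ℝ, R22)) 𝓘(ℝ, ImB) (prodNormal f o) x v : ImB) =
      (diffNormal f o x.1 v.1, 0) := by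
  have h1 := ((hf.contMDiff_unitNormal ho).mdifferentiableAt (by simp)
    (x := x.1)).hasMFDerivAt.comp x (hasMFDerivAt_fst (I := 𝓡 2) (I' := 𝓘(ℝ, R22)) x)
  have h2 := hasMFDerivAt_const (I := (𝓡 2).prod 𝓘(ℝ, R22)) (I' := 𝓘(ℝ, R22)) (0 : R22) x
  have h3 := (hasMFDerivAt_prodMk_space h1 h2).mfderiv
  exact congrArg (fun T : EuclideanSpace ℝ (Fin 2) × R22 →L[ℝ] ImB => T v) h3

lemma contMDiff_prodNormal (hf : IsLorentzianImmersion f) (ho : IsOrientation o) :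
    ContMDiff ((𝓡 2).prod 𝓘(ℝ, R22)) 𝓘(ℝ, ImB) ∞ (prodNormal f o) :=
  ((hf.contMDiff_unitNormal ho).comp contMDiff_fst).prodMk_space contMDiff_const

/-- The defining choice is not vacuous: `n × df(v)` is orthogonal to `n`, hence tangent, so `-X(ν,
·)` preserves the image of the injective differential. -/
lemma prodParacomplex_spec (s : ℝ) (hf : IsLorentzianImmersion f)
    (o : ∀ p : S, Orientation ℝ (TangentSpace (𝓡 2) p) (Fin 2)) (x : S × R22)
    (v : TangentSpace ((𝓡 2).prod 𝓘(ℝ, R22)) x) :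
    (mfderiv ((𝓡 2).prod 𝓘(ℝ, R22)) 𝓘(ℝ, ImB) (prodImmersion f) x
      (prodParacomplex s f o x v) : ImB) =
    -crossL (prodNormal f o x)
      (mfderiv ((𝓡 2).prod 𝓘(ℝ, R22)) 𝓘(ℝ, ImB) (prodImmersion f) x v) := by
  have hcr : ∀ z, cross s (prodNormal f o x) z = crossL (prodNormal f o x) z := fun z =>
    cross_mk_zero s _ z.1 z.2
  let A : TangentSpace ((𝓡 2).prod 𝓘(ℝ, R22)) x →ₗ[ℝ] ImB :=
    (mfderiv ((𝓡 2).prod 𝓘(ℝ, R22)) 𝓘(ℝ, ImB) (prodImmersion f) x :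
      (EuclideanSpace ℝ (Fin 2) × R22) →L[ℝ] ImB).toLinearMap
  obtain ⟨L, hL⟩ := exists_linearMap_comp_eq A (mfderiv_prodImmersion_injective hf x)
    (-crossL (prodNormal f o x)).toLinearMap (by
      intro v
      obtain ⟨w, hw⟩ := hf.exists_diff_eq (o := o) (p := x.1)
        (u := -cross12 (unitNormal f o x.1) (diff f x.1 (v : EuclideanSpace ℝ (Fin 2) × R22).1)) (by
          rw [inner12_neg_right, inner12_comm, inner12_cross12_left, neg_zero])
      refine ⟨((w, -mulRight (v : EuclideanSpace ℝ (Fin 2) × R22).2 (unitNormal f o x.1)) :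
        EuclideanSpace ℝ (Fin 2) × R22), ?_⟩
      refine (mfderiv_prodImmersion hf x _).trans ?_
      refine Eq.trans ?_ (congrArg (fun z => -crossL (prodNormal f o x) z)
        (mfderiv_prodImmersion hf x v)).symm
      exact Prod.ext hw rfl)
  have hex : ∃ L : TangentSpace ((𝓡 2).prod 𝓘(ℝ, R22)) x →ₗ[ℝ]
      TangentSpace ((𝓡 2).prod 𝓘(ℝ, R22)) x, ∀ v,
      (show ImB from mfderiv ((𝓡 2).prod 𝓘(ℝ, R22)) 𝓘(ℝ, ImB) (prodImmersion f) x (L v)) =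
      -cross s (prodNormal f o x)
        (mfderiv ((𝓡 2).prod 𝓘(ℝ, R22)) 𝓘(ℝ, ImB) (prodImmersion f) x v) :=
    ⟨L, fun v => (hL v).trans (congrArg Neg.neg (hcr _)).symm⟩
  exact (Classical.epsilon_spec hex v).trans (congrArg Neg.neg (hcr _))

lemma prodParacomplex_sq (s : ℝ) (hf : IsLorentzianImmersion f)
    (o : ∀ p : S, Orientation ℝ (TangentSpace (𝓡 2) p) (Fin 2)) (x : S × R22)
    (v : TangentSpace ((𝓡 2).prod 𝓘(ℝ, R22)) x) :
    prodParacomplex s f o x (prodParacomplex s f o x v) = v := by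
  apply mfderiv_prodImmersion_injective hf x
  obtain ⟨hn, ht, -⟩ := hf.unitNormal_spec o x.1
  refine (prodParacomplex_spec s hf o x _).trans ?_
  refine (congrArg (fun z => -crossL (prodNormal f o x) z)
    (prodParacomplex_spec s hf o x v)).trans ?_
  refine (congrArg (fun z => -crossL (prodNormal f o x) (-crossL (prodNormal f o x) z))
    (mfderiv_prodImmersion hf x v)).trans ?_
  refine Eq.trans ?_ (mfderiv_prodImmersion hf x v).symm
  rw [map_neg, neg_neg]
  refine Prod.ext (cross12_cross12_normal hn (ht _)) ?_
  refine (mulRight_mulRight _ _ _).trans ?_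
  change mulRight _ (cross12 (unitNormal f o x.1) (unitNormal f o x.1))
    - inner12 (unitNormal f o x.1) (unitNormal f o x.1) • _ = _
  rw [cross12_self, hn]
  have h0 : ∀ y, mulRight y 0 = 0 := fun y => by simpa using mulRight_smul_right 0 y 0
  rw [h0, neg_one_smul, sub_neg_eq_add, zero_add]

lemma contMDiffAt_prodParacomplex (s : ℝ) (hf : IsLorentzianImmersion f) (ho : IsOrientation o)
    {x : S × R22} {V : ∀ x : S × R22, TangentSpace ((𝓡 2).prod 𝓘(ℝ, R22)) x}
    (hV : ContMDiffAt ((𝓡 2).prod 𝓘(ℝ, R22)) ((𝓡 2).prod 𝓘(ℝ, R22)).tangent ∞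
      (fun x => (⟨x, V x⟩ : TangentBundle ((𝓡 2).prod 𝓘(ℝ, R22)) (S × R22))) x) :
    ContMDiffAt ((𝓡 2).prod 𝓘(ℝ, R22)) ((𝓡 2).prod 𝓘(ℝ, R22)).tangent ∞
      (fun x => (⟨x, prodParacomplex s f o x (V x)⟩ :
        TangentBundle ((𝓡 2).prod 𝓘(ℝ, R22)) (S × R22))) x := by
  refine contMDiffAt_of_dirDeriv (contMDiff_prodImmersion hf)
    (mfderiv_prodImmersion_injective hf x) ?_
  have h1 : dirDeriv ((𝓡 2).prod 𝓘(ℝ, R22)) (fun x => prodParacomplex s f o x (V x))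
      (prodImmersion f) = fun y => -crossL (prodNormal f o y)
        (dirDeriv ((𝓡 2).prod 𝓘(ℝ, R22)) V (prodImmersion f) y) :=
    funext fun y => prodParacomplex_spec s hf o y (V y)
  rw [h1]
  exact ((crossL.contMDiff.contMDiffAt.comp x (contMDiff_prodNormal hf ho).contMDiffAt).clm_apply
    (contMDiffAt_dirDeriv (contMDiff_prodImmersion hf) hV)).neg

lemma mfderiv_prodParacomplex (s : ℝ) (hf : IsLorentzianImmersion f)
    (o : ∀ p : S, Orientation ℝ (TangentSpace (𝓡 2) p) (Fin 2)) (x : S × R22)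
    (v : EuclideanSpace ℝ (Fin 2) × R22) :
    (mfderiv ((𝓡 2).prod 𝓘(ℝ, R22)) 𝓘(ℝ, ImB) (prodImmersion f) x
      (prodParacomplex s f o x v) : ImB) =
      (-cross12 (unitNormal f o x.1) (diff f x.1 v.1), -mulRight v.2 (unitNormal f o x.1)) :=
  (prodParacomplex_spec s hf o x v).trans (congrArg (fun z => -crossL (prodNormal f o x) z)
    (mfderiv_prodImmersion hf x v))

lemma two_mul_finrank_eigenspace_prodParacomplex (s : ℝ) (hf : IsLorentzianImmersion f)
    (o : ∀ p : S, Orientation ℝ (TangentSpace (𝓡 2) p) (Fin 2)) (x : S × R22) :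
    2 * Module.finrank ℝ (Module.End.eigenspace (prodParacomplex s f o x) 1) =
        Module.finrank ℝ (EuclideanSpace ℝ (Fin 2) × R22) ∧
      2 * Module.finrank ℝ (Module.End.eigenspace (prodParacomplex s f o x) (-1)) =
        Module.finrank ℝ (EuclideanSpace ℝ (Fin 2) × R22) := by
  obtain ⟨e, he, -, -⟩ := hf.signature x.1
  have ht := (hf.unitNormal_spec o x.1).2.1
  have hA : ∀ v, _ := fun v => (mfderiv_prodImmersion hf x (prodParacomplex s f o x v)).symm.trans
    (mfderiv_prodParacomplex s hf o x v)
  obtain ⟨P, hP, hPL⟩ := exists_anticommuting (T := EuclideanSpace ℝ (Fin 2))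
    (D := (diff f x.1 : EuclideanSpace ℝ (Fin 2) →L[ℝ] R12).toLinearMap) (hf.injective x.1)
    he ht (L := prodParacomplex s f o x) (fun v => congrArg Prod.fst (hA v))
    (fun v => congrArg Prod.snd (hA v))
  have : FiniteDimensional ℝ (TangentSpace ((𝓡 2).prod 𝓘(ℝ, R22)) x) :=
    inferInstanceAs (FiniteDimensional ℝ (EuclideanSpace ℝ (Fin 2) × R22))
  exact two_mul_finrank_eigenspace (T := TangentSpace ((𝓡 2).prod 𝓘(ℝ, R22)) x)
    (L := prodParacomplex s f o x) (prodParacomplex_sq s hf o x) hP hPL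

lemma isAlmostParacomplex_prodParacomplex (s : ℝ) (hf : IsLorentzianImmersion f)
    (ho : IsOrientation o) :
    IsAlmostParacomplex ((𝓡 2).prod 𝓘(ℝ, R22)) (prodParacomplex s f o) where
  smooth _ _ hU hV x hx :=
    (contMDiffAt_prodParacomplex s hf ho
      ((hV x hx).contMDiffAt (hU.mem_nhds hx))).contMDiffWithinAt
  sq_eq := prodParacomplex_sq s hf o
  finrank_pos x := (two_mul_finrank_eigenspace_prodParacomplex s hf o x).1
  finrank_neg x := (two_mul_finrank_eigenspace_prodParacomplex s hf o x).2

/-- The Nijenhuis expression of `Σ × ℝ^{2,2}`: only its component along `ℝ^{2,2}` survives. -/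
lemma mfderiv_nijenhuis_prodParacomplex (s : ℝ) (hf : IsLorentzianImmersion f)
    (ho : IsOrientation o) {x : S × R22}
    {V W : ∀ x : S × R22, TangentSpace ((𝓡 2).prod 𝓘(ℝ, R22)) x}
    (hV : ContMDiffAt ((𝓡 2).prod 𝓘(ℝ, R22)) ((𝓡 2).prod 𝓘(ℝ, R22)).tangent ∞
      (fun x => (⟨x, V x⟩ : TangentBundle ((𝓡 2).prod 𝓘(ℝ, R22)) (S × R22))) x)
    (hW : ContMDiffAt ((𝓡 2).prod 𝓘(ℝ, R22)) ((𝓡 2).prod 𝓘(ℝ, R22)).tangent ∞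
      (fun x => (⟨x, W x⟩ : TangentBundle ((𝓡 2).prod 𝓘(ℝ, R22)) (S × R22))) x)
    {J : EuclideanSpace ℝ (Fin 2) → EuclideanSpace ℝ (Fin 2)}
    (hJ : ∀ v, diff f x.1 (J v) = -cross12 (unitNormal f o x.1) (diff f x.1 v))
    {v w : EuclideanSpace ℝ (Fin 2) × R22} (hv : V x = v) (hw : W x = w) :
    (mfderiv ((𝓡 2).prod 𝓘(ℝ, R22)) 𝓘(ℝ, ImB) (prodImmersion f) x
      (nijenhuis ((𝓡 2).prod 𝓘(ℝ, R22)) (prodParacomplex s f o) V W x) : ImB) =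
    (0, mulRight v.2 (diffNormal f o x.1 (J w.1) +
        cross12 (diffNormal f o x.1 w.1) (unitNormal f o x.1)) -
      mulRight w.2 (diffNormal f o x.1 (J v.1) +
        cross12 (diffNormal f o x.1 v.1) (unitNormal f o x.1))) := by
  have h := hf.isGaussData ho x.1
  have h1 := mfderiv_nijenhuis crossL (contMDiff_prodImmersion hf) (prodParacomplex_spec s hf o)
    (prodParacomplex_sq s hf o x) ((contMDiff_prodNormal hf ho).mdifferentiableAt (by simp)) hV hW
    (contMDiffAt_prodParacomplex s hf ho hV) (contMDiffAt_prodParacomplex s hf ho hW)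
  have hA := mfderiv_prodImmersion hf x
  have hfst : ∀ u : EuclideanSpace ℝ (Fin 2) × R22,
      (prodParacomplex s f o x u : EuclideanSpace ℝ (Fin 2) × R22).1 = J u.1 := fun u =>
    hf.injective x.1 ((congrArg Prod.fst ((mfderiv_prodImmersion hf x _).symm.trans
      (mfderiv_prodParacomplex s hf o x u))).trans (hJ u.1).symm)
  have hB : ∀ u : EuclideanSpace ℝ (Fin 2) × R22,
      (mfderiv ((𝓡 2).prod 𝓘(ℝ, R22)) 𝓘(ℝ, ImB) (prodNormal f o) x (prodParacomplex s f o x u) :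
        ImB) = (diffNormal f o x.1 (J u.1), 0) := fun u =>
    (mfderiv_prodNormal hf ho x _).trans (by rw [hfst])
  rw [hv, hw] at h1
  refine h1.trans ?_
  have hB' := mfderiv_prodNormal hf ho x
  refine (congr (congrArg (fun (a b : ImB) => a + b) (congr (congrArg (fun (a b : ImB) => a + b)
    (congrArg Neg.neg (congr (congrArg (fun a b => crossL a b) (hB v)) (hA w))))
    (congr (congrArg (fun a b => crossL a b) (hB w)) (hA v))))
    (congrArg (crossL (prodNormal f o x)) (congr (congrArg (fun (a b : ImB) => a - b)
      (congr (congrArg (fun a b => crossL a b) (hB' w)) (hA v)))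
      (congr (congrArg (fun a b => crossL a b) (hB' v)) (hA w))))).trans ?_
  -- In the `ℝ^{1,2}`-component, `e1` cancels the two terms containing `J`, while `e2` and `e3` kill
  -- the others, as `n ×` annihilates multiples of `n`.
  have e1 := h.cross_gauss hJ v.1 w.1
  have e2 := h.cross_cross_gauss v.1 w.1
  have e3 := h.cross_cross_gauss w.1 v.1
  have e4 := h.inner_gauss v.1
  have e5 := h.inner_gauss w.1
  simp only [ContinuousLinearMap.coe_coe] at e1 e2 e3 e4 e5
  simp only [crossL_apply, prodNormal]
  refine Prod.ext ?_ ?_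
  · simp only [Prod.fst_add, Prod.fst_neg, Prod.fst_sub]
    rw [e1, sub_eq_add_neg, ← neg_one_smul ℝ (cross12 (diffNormal f o x.1 v.1) _),
      cross12_add_right, cross12_smul_right, e2, e3]
    simp
  · exact mulRight_nijenhuis _ _ _ _ e4 e5

/-- `Σ × ℝ^{2,2}` is integrable iff the Gauss map of `Σ` is compatible with the paracomplex
structures. -/
lemma isIntegrable_prodParacomplex_iff (s : ℝ) (hf : IsLorentzianImmersion f)
    (ho : IsOrientation o) :
    IsIntegrable ((𝓡 2).prod 𝓘(ℝ, R22)) (prodParacomplex s f o) ↔ IsMinimal f o := by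
  have hJ : ∀ p : S, ∃ J : EuclideanSpace ℝ (Fin 2) → EuclideanSpace ℝ (Fin 2),
      ∀ v, diff f p (J v) = -cross12 (unitNormal f o p) (diff f p v) := fun p =>
    Classical.axiomOfChoice fun v => hf.exists_diff_eq (o := o) (p := p) (by
      rw [inner12_neg_right, inner12_comm, inner12_cross12_left, neg_zero])
  constructor
  · intro hI p
    obtain ⟨J, hJ⟩ := hJ p
    refine (hf.meanCurvature_eq_zero_iff ho hJ).2 fun v => ?_
    let x : S × R22 := (p, 0)
    have : IsManifold ((𝓡 2).prod 𝓘(ℝ, R22)) 1 (S × R22) := IsManifold.of_le (n := ∞) (by simp)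
    let v' : TangentSpace ((𝓡 2).prod 𝓘(ℝ, R22)) x :=
      ((v, 0) : EuclideanSpace ℝ (Fin 2) × R22)
    -- The `ℝ^{2,2}`-part is the unit of `𝕌`, on which right multiplication by `p` returns `p`; with
    -- `v'` having no such part, the Nijenhuis expression becomes `-Q(v)`.
    let w' : TangentSpace ((𝓡 2).prod 𝓘(ℝ, R22)) x :=
      ((0, !₂[1, 0, 0, 0]) : EuclideanSpace ℝ (Fin 2) × R22)
    let F := EuclideanSpace ℝ (Fin 2) × R22
    -- Integrability speaks of fields on open sets, so the two vectors are extended to local smooth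
    -- fields, restricted to a common open neighbourhood.
    obtain ⟨U, hU, hV⟩ := FiberBundle.exists_contMDiffOn_extend (k := ∞)
      ((𝓡 2).prod 𝓘(ℝ, R22)) F v'
    obtain ⟨U', hU', hW⟩ := FiberBundle.exists_contMDiffOn_extend (k := ∞)
      ((𝓡 2).prod 𝓘(ℝ, R22)) F w'
    have hUU : interior (U ∩ U') ∈ 𝓝 x := interior_mem_nhds.2 (inter_mem hU hU')
    have hN := hI (interior (U ∩ U')) (FiberBundle.extend F v') (FiberBundle.extend F w')
      isOpen_interior (hV.mono (interior_subset.trans inter_subset_left))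
      (hW.mono (interior_subset.trans inter_subset_right)) x (mem_of_mem_nhds hUU)
    have h1 := mfderiv_nijenhuis_prodParacomplex s hf ho (hV.contMDiffAt hU) (hW.contMDiffAt hU')
      hJ (FiberBundle.extend_apply_self F v') (FiberBundle.extend_apply_self F w')
    rw [hN] at h1
    have h2 := congrArg Prod.snd ((map_zero (mfderiv ((𝓡 2).prod 𝓘(ℝ, R22)) 𝓘(ℝ, ImB)
      (prodImmersion f) x)).symm.trans h1)
    have h3 : ∀ (q : R12) {p : R12},
        (0 : R22) = mulRight 0 q - mulRight !₂[1, 0, 0, 0] p → p = 0 := by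
      intro q p h
      have h0 : mulRight 0 q = 0 := by simpa using mulRight_smul_left 0 0 q
      rw [h0, zero_sub, eq_comm, neg_eq_zero] at h
      exact eq_zero_of_mulRight_one h
    exact h3 _ h2
  · intro hm U V W hU hV hW x hx
    obtain ⟨J, hJ⟩ := hJ x.1
    have hQ := (hf.meanCurvature_eq_zero_iff ho hJ).1 (hm x.1)
    apply mfderiv_prodImmersion_injective hf x
    refine (mfderiv_nijenhuis_prodParacomplex s hf ho ((hV x hx).contMDiffAt (hU.mem_nhds hx))
      ((hW x hx).contMDiffAt (hU.mem_nhds hx)) hJ rfl rfl).trans ?_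
    have h0 : ∀ y, mulRight y 0 = 0 := fun y => by simpa using mulRight_smul_right 0 y 0
    refine Eq.trans ?_ (map_zero (mfderiv ((𝓡 2).prod 𝓘(ℝ, R22)) 𝓘(ℝ, ImB)
      (prodImmersion f) x)).symm
    have hz : ∀ (y z : R22) {p q : R12}, q = 0 → p = 0 →
        ((0, mulRight y q - mulRight z p) : ImB) = 0 := by
      rintro y z _ _ rfl rfl
      rw [h0, h0, sub_zero]; rfl
    exact hz _ _ (hQ _) (hQ _)

end Product

end

end ParaCalabi

theorem mainTheorem6 (s : ℝ) (hs : s = 1 ∨ s = -1)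
    {S : Type*} [TopologicalSpace S] [ChartedSpace (EuclideanSpace ℝ (Fin 2)) S]
    [IsManifold (𝓡 2) ∞ S]
    (f : S → ParaCalabi.R12) (hf : ParaCalabi.IsLorentzianImmersion f)
    (o : ∀ p : S, Orientation ℝ (TangentSpace (𝓡 2) p) (Fin 2))
    (ho : ParaCalabi.IsOrientation o) :
    ParaCalabi.IsAlmostParacomplex ((𝓡 2).prod 𝓘(ℝ, ParaCalabi.R22))
        (ParaCalabi.prodParacomplex s f o) ∧
      (ParaCalabi.IsIntegrable ((𝓡 2).prod 𝓘(ℝ, ParaCalabi.R22))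
          (ParaCalabi.prodParacomplex s f o) ↔
        ParaCalabi.IsMinimal f o) :=
  ⟨ParaCalabi.isAlmostParacomplex_prodParacomplex s hf ho,
    ParaCalabi.isIntegrable_prodParacomplex_iff s hf ho⟩
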